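/- Let $f\colon \mathbb A^3_{\mathbb Q}\to\mathbb A^3_{\mathbb Q}$, $f(x,y,z)=(y,\;x+y-y^3,\;2z-y)$. For $n\ge 1$ let $\mathrm{Per}_n(f)=\{P\in\mathbb A^3(\overline{\mathbb Q}) : f^n(P)=P\}$ and $\mathrm{Per}(f)=\bigcup_{n\ge1}\mathrm{Per}_n(f)$. A point $P\in\mathrm{Per}(f)$ is called isolated if, for every $n\ge 1$, it does not lie in the Zariski closure of $\mathrm{Per}_n(f)\setminus\{P\}$; the same definitions are used for self-morphisms of $\mathbb A^N_{\overline{\mathbb Q}}$. Let $h$ be the restriction to $\mathbb A^N(\overline{\mathbb Q})\subset\mathbb P^N(\overline{\mathbb Q})$, $(x_1,\dots,x_N)\mapsto(1:x_1:\dots:x_N)$, of the absolute logarithmic Weil height. For $0\le p\le 3$ let $d_p(f)=\lim_{n\to\infty}\deg_p(f^n)^{1/n}$ be the $p$-th dynamical degree, where $\deg_p(g)$ is the degree of the preimage under $g$ of a general linear subspace of codimension $p$, i.e. the number of points of a general linear subspace of codimension $3-p$ that $g$ maps into a general linear subspace of codimension $p$. Then the following hold. 1. The morphism $f$ is an automorphism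 of $\mathbb A^3_{\mathbb Q}$, and $d_1(f)=d_2(f)=3$. 2. For every $n\ge1$ the set $\mathrm{Per}_n(f)$ is finite; thus all periodic points of $f$ are isolated. 3. There is a sequence $(P_i)_{i\ge1}$ of points of $\mathrm{Per}(f)$ such that $\lim_{i\to\infty}h(P_i)=\infty$ and $\{P_i : i\ge1\}$ is Zariski dense in $\mathbb A^3_{\overline{\mathbb Q}}$. Consequently, $f$ has degree at least two and its set of isolated periodic points has unbounded height, so the following conjecture of Silverman is false: for every automorphism of $\mathbb A^N_{\overline{\mathbb Q}}$ whose coordinate polynomials have maximal degree at least two, the set of isolated periodic points has bounded height. -/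

import Mathlib

open Filter Topology

/-- The field of algebraic numbers. -/
abbrev Qbar : Type := AlgebraicClosure ℚ

instance isAlgebraic_Qbar : Algebra.IsAlgebraic ℚ Qbar := AlgebraicClosure.isAlgebraic ℚ

namespace AffineDyn

variable {N : ℕ} {k : Type} [Field k]

/-! ### Polynomial self-maps of affine space -/

/-- A morphism `𝔸ᴺ → 𝔸ᴺ` over `k`, given by its coordinate polynomials, is an automorphism:
its comorphism `k[x] → k[x]`, `xᵢ ↦ Fᵢ`, is an isomorphism. -/
def IsAutomorphism (F : Fin N → MvPolynomial (Fin N) k) : Prop :=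
  Function.Bijective (MvPolynomial.aeval (R := k) F : MvPolynomial (Fin N) k →ₐ[k] _)

/-- The maximum of the total degrees of the coordinate polynomials. -/
def degree (F : Fin N → MvPolynomial (Fin N) k) : ℕ :=
  Finset.univ.sup fun i => (F i).totalDegree

/-- The action of a polynomial self-map of `𝔸ᴺ` over `k` on the points `𝔸ᴺ(ℚ̄)`. -/
noncomputable def onPoints [Algebra k Qbar] (F : Fin N → MvPolynomial (Fin N) k) :
    (Fin N → Qbar) → (Fin N → Qbar) :=
  fun P i => MvPolynomial.aeval P (F i)

/-! ### Zariski topology and periodic points -/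

/-- The set of `ℚ̄`-points of the Zariski closure in `𝔸ᴺ` over `ℚ̄` of a set of `ℚ̄`-points. -/
def zariskiClosure (S : Set (Fin N → Qbar)) : Set (Fin N → Qbar) :=
  MvPolynomial.zeroLocus Qbar (MvPolynomial.vanishingIdeal Qbar S)

/-- `Per_n(f, 𝔸ᴺ(ℚ̄))`, for a self-map `φ` of `𝔸ᴺ(ℚ̄)` and `n ≥ 1`. -/
def Per (n : ℕ) (φ : (Fin N → Qbar) → (Fin N → Qbar)) : Set (Fin N → Qbar) :=
  {P | φ^[n] P = P}

/-- `Per(f, 𝔸ᴺ(ℚ̄))`, the set of all periodic points. -/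
def PerAll (φ : (Fin N → Qbar) → (Fin N → Qbar)) : Set (Fin N → Qbar) :=
  {P | ∃ n : ℕ, 1 ≤ n ∧ P ∈ Per n φ}

/-- The isolated periodic points: for every `n ≥ 1`, the point is not in the Zariski closure of the
set of the other `n`-periodic points. -/
def IsolatedPer (φ : (Fin N → Qbar) → (Fin N → Qbar)) : Set (Fin N → Qbar) :=
  {P | P ∈ PerAll φ ∧ ∀ n : ℕ, 1 ≤ n → P ∉ zariskiClosure (Per n φ \ {P})}

/-! ### Dynamical degrees -/

/-- The value at `x` of the `i`-th of `N` affine forms with coefficients `a`. -/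
noncomputable def affineForm (a : Fin N × Option (Fin N) → Qbar) (i : Fin N) (x : Fin N → Qbar) :
    Qbar :=
  a (i, none) + ∑ j, a (i, some j) * x j

/-- `d` is the `p`-th degree (`0 ≤ p ≤ N`) of the polynomial self-map `φ` of `𝔸ᴺ(ℚ̄)`, viewed as a
rational self-map of `ℙᴺ`, that is, the intersection number `(φ^* Hᵖ · Hᴺ⁻ᵖ)`, which is the degree
of the preimage of a general linear subspace of codimension `p`: for a general linear subspace `L`
of codimension `p` and a general linear subspace `M` of codimension `N - p`, exactly `d` points
of `M` are mapped into `L`. Here `L` is cut out by the forms of index `i < p` and `M` by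
the other ones, and "general" means outside of a hypersurface `Φ = 0` in the space of all
coefficients. -/
def HasDegree (φ : (Fin N → Qbar) → (Fin N → Qbar)) (p d : ℕ) : Prop :=
  ∃ Φ : MvPolynomial (Fin N × Option (Fin N)) Qbar, Φ ≠ 0 ∧
    ∀ a : Fin N × Option (Fin N) → Qbar, MvPolynomial.eval a Φ ≠ 0 →
      {x : Fin N → Qbar |
        (∀ i : Fin N, i.val < p → affineForm a i (φ x) = 0) ∧
        (∀ i : Fin N, p ≤ i.val → affineForm a i x = 0)}.encard = d

/-- `δ` is the `p`-th dynamical degree of `φ`: the limit of `deg_p(φⁿ)^(1/n)` as `n → ∞`. -/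
def HasDynamicalDegree (φ : (Fin N → Qbar) → (Fin N → Qbar)) (p : ℕ) (δ : ℝ) : Prop :=
  ∃ d : ℕ → ℕ, (∀ n, HasDegree φ^[n] p (d n)) ∧
    Tendsto (fun n : ℕ => (d n : ℝ) ^ (1 / (n : ℝ))) atTop (𝓝 δ)

/-! ### Heights -/

/-- The field generated by the coordinates of a point. -/
noncomputable abbrev fieldOfDef (P : Fin N → Qbar) : IntermediateField ℚ Qbar :=
  IntermediateField.adjoin ℚ (Set.range P)

instance numberField_fieldOfDef (P : Fin N → Qbar) : NumberField (fieldOfDef P) where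
  to_charZero := inferInstance
  to_finiteDimensional :=
    IntermediateField.finiteDimensional_adjoin fun x _ => Algebra.IsIntegral.isIntegral x

/-- The coordinates of a point, as elements of the field that they generate. -/
noncomputable def coords (P : Fin N → Qbar) : Fin N → fieldOfDef P :=
  fun i => ⟨P i, IntermediateField.subset_adjoin ℚ _ ⟨i, rfl⟩⟩

/-- The restriction to `𝔸ᴺ(ℚ̄)` of the naive (absolute logarithmic Weil) height on `ℙᴺ(ℚ̄)`:
the height of `(1 : x₁ : ... : x_N)`. Mathlib's `Height.logHeight` is relative to the field `K`,
so it is divided by `[K : ℚ]`. -/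
noncomputable def height (P : Fin N → Qbar) : ℝ :=
  Height.logHeight (Matrix.vecCons (1 : fieldOfDef P) (coords P)) /
    (Module.finrank ℚ (fieldOfDef P) : ℝ)

/-- A set of points of `𝔸ᴺ(ℚ̄)` has bounded height. -/
def HeightBounded (S : Set (Fin N → Qbar)) : Prop :=
  ∃ C : ℝ, ∀ P ∈ S, |height P| ≤ C

/-- Silverman's conjecture: the isolated periodic points of an automorphism of degree at least two
of an affine space over `ℚ̄` form a set of bounded height. -/
def SilvermanConjecture : Prop :=
  ∀ (N : ℕ) (F : Fin N → MvPolynomial (Fin N) Qbar), IsAutomorphism F → 2 ≤ degree F →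
    HeightBounded (IsolatedPer (onPoints F))

/-! ### The map `(x, y, z) ↦ (y, x + y - y³, 2z - y)` -/

open MvPolynomial in
/-- The coordinate polynomials over `ℚ` of `(x, y, z) ↦ (y, x + y - y³, 2z - y)`. -/
noncomputable def f : Fin 3 → MvPolynomial (Fin 3) ℚ :=
  ![X 1, X 0 + X 1 - X 1 ^ 3, 2 * X 2 - X 1]

end AffineDyn

/-! The map is a skew product over the plane Hénon map g(x, y) = (y, x + y - y³). Along a g-orbit
the first coordinates satisfy x_{k+1}³ = x_k + x_{k+1} - x_{k+2}. On a cycle of length n every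
monomial in them therefore reduces to exponents below 3, so there are at most 3ⁿ such points and
their plane coordinates are algebraic integers (`card_le_of_cube_mem`, `isIntegral_of_cube_mem`).
The third coordinate is then forced: it is the sum of the 2^(n-1-k) y_k divided by 2ⁿ - 1
(`mem_Per_iff`). Large heights come from the 3-adic size of this quotient.

Take n = 2·3^m. Modulo 3 the map g is additive and satisfies M² = 1 + (1 - τ)M with τ the Frobenius;
the 3^m-th power of this relation shows that gⁿ fixes every point over the field with 3^(3^m)
elements. These are 3ⁿ points, as many as the bound allows, and each lifts to a periodic point in
characteristic zero by a contraction argument (`exists_periodic_near`). The numerator reduces to the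
difference of the traces of the two coordinates, while 3^(m+1) divides 2ⁿ - 1. By Schwartz–Zippel,
for large m, at least 3ⁿ/3 points have a unit numerator, hence |z|₃ ≥ 3^m, and also lie off a
prescribed hypersurface (`exists_many_periodic`).

The n-periodic points are Galois stable, so by pigeonhole at least a third of some Galois orbit
consists of such points, which forces height at least (m log 3)/3 (`le_height_of_conjugates`,
`exists_periodic_height_gt`). There are countably many hypersurfaces; one point off each, with
growing height, gives the dense sequence.

For the dynamical degrees, fⁿ and f⁻ⁿ both have degree 3ⁿ, and deg₂(fⁿ) = deg₁(f⁻ⁿ). The count on a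
generic line rests on the nonvanishing of a discriminant, checked on one explicit line and plane
(`exists_generic_line`). -/

namespace AffineDyn

/-! ### Counting the zeros of a generic member of a family of polynomials -/

section Generic

variable {k : Type*} [Field k]

/-- Substituting fractions with a common denominator `Δ` into a polynomial, and clearing
denominators, gives a polynomial. -/
lemma exists_clear_denominators {σ τ : Type*} (Δ : MvPolynomial τ k)
    (ν : σ → MvPolynomial τ k) (Ψ : MvPolynomial σ k) :
    ∃ (e : ℕ) (Φ : MvPolynomial τ k), ∀ a : τ → k, MvPolynomial.eval a Δ ≠ 0 →
      MvPolynomial.eval a Φ = MvPolynomial.eval a Δ ^ e *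
        MvPolynomial.eval (fun s => MvPolynomial.eval a (ν s) / MvPolynomial.eval a Δ) Ψ := by
  induction Ψ using MvPolynomial.induction_on with
  | C c => exact ⟨0, MvPolynomial.C c, fun a _ => by simp⟩
  | add p r hp hr =>
    obtain ⟨e₁, Φ₁, h₁⟩ := hp
    obtain ⟨e₂, Φ₂, h₂⟩ := hr
    refine ⟨e₁ + e₂, Δ ^ e₂ * Φ₁ + Δ ^ e₁ * Φ₂, fun a ha => ?_⟩
    simp only [map_add, map_mul, map_pow, h₁ a ha, h₂ a ha]
    ring
  | mul_X p s hp =>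
    obtain ⟨e, Φ, h⟩ := hp
    refine ⟨e + 1, Φ * ν s, fun a ha => ?_⟩
    simp only [map_mul, MvPolynomial.eval_X, h a ha]
    rw [pow_succ]
    field_simp

open Polynomial in
/-- If the `D`-th coefficient and the resultant with the derivative do not vanish, then a
polynomial of degree at most `D` over an algebraically closed field has exactly `D` zeros. -/
lemma encard_zeros_eq_of_resultant_ne_zero [IsAlgClosed k] {D : ℕ} {p : k[X]}
    (hd : p.natDegree ≤ D) (hc : p.coeff D ≠ 0)
    (hr : p.resultant (derivative p) D (D - 1) ≠ 0) :
    {t : k | p.eval t = 0}.encard = D := by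
  have hdeg : p.natDegree = D := natDegree_eq_of_le_of_coeff_ne_zero hd hc
  have hp0 : p ≠ 0 := by rintro rfl; simp at hc
  have hsplit : p.Splits := IsAlgClosed.splits p
  have hder : (derivative p).natDegree ≤ D - 1 := hdeg ▸ natDegree_derivative_le p
  have hres := resultant_eq_prod_eval p (derivative p) (D - 1) hder hsplit
  rw [hdeg] at hres
  rw [hres] at hr
  have hprod := right_ne_zero_of_mul hr
  have hnodup : p.roots.Nodup := by
    classical
    rw [Multiset.nodup_iff_count_le_one]
    intro t
    by_contra! hlt
    rw [count_roots] at hlt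
    have h := (one_lt_rootMultiplicity_iff_isRoot hp0).1 hlt
    refine hprod (Multiset.prod_eq_zero (Multiset.mem_map.2 ⟨t, ?_, h.2⟩))
    exact (mem_roots hp0).2 h.1
  classical
  have hset : {t : k | p.eval t = 0} = (p.roots.toFinset : Set k) := by
    ext t
    simp [hp0]
  rw [hset, Set.encard_coe_eq_coe_finsetCard, Multiset.toFinset_card_of_nodup hnodup,
    ← hdeg, hsplit.natDegree_eq_card_roots]

open Polynomial in
-- Converse direction to the count above, used to see that the genericity condition holds for one
-- special member of the family.
lemma resultant_derivative_ne_zero_of_simple_roots [IsAlgClosed k] {p : k[X]} (hp : p ≠ 0)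
    (h : ∀ t, p.eval t = 0 → (derivative p).eval t ≠ 0) :
    p.resultant (derivative p) p.natDegree (p.natDegree - 1) ≠ 0 := by
  rw [resultant_eq_prod_eval p (derivative p) _ (natDegree_derivative_le p)
    (IsAlgClosed.splits p)]
  refine mul_ne_zero (pow_ne_zero _ (leadingCoeff_ne_zero.2 hp)) (Multiset.prod_ne_zero ?_)
  rw [Multiset.mem_map]
  rintro ⟨t, ht, ht0⟩
  exact h t ((mem_roots hp).1 ht) ht0

open Polynomial in
/-- All but finitely many translates of a nonconstant polynomial have only simple zeros. -/
lemma exists_translate_simple_roots [CharZero k] [IsAlgClosed k] {p : k[X]} (hp : 0 < p.natDegree) :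
    ∃ c : k, ∀ t, (C c + p).eval t = 0 → (derivative (C c + p)).eval t ≠ 0 := by
  classical
  -- A multiple zero t of c + p is a zero of p' with c = -p(t), so only finitely many c are bad.
  obtain ⟨c, hc⟩ := Infinite.exists_notMem_finset
    ((derivative p).roots.toFinset.image fun t => -p.eval t)
  refine ⟨c, fun t ht h0 => hc (Finset.mem_image.2 ⟨t, ?_, ?_⟩)⟩
  · have hd : derivative p ≠ 0 := fun h => hp.ne' (derivative_eq_zero.1 h)
    simpa [hd] using h0
  · simp only [eval_add, eval_C] at ht
    linear_combination -ht

end Generic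

end AffineDyn

namespace AffineDyn

/-! ### Generic lines and polynomial maps -/

section GenericLine

variable {k : Type} [Field k]

/-- The parameters of a parametrized line in affine `3`-space (base point and direction) together
with an affine form. -/
abbrev LineParam : Type := (Fin 3 × Fin 2) ⊕ Option (Fin 3)

/-- The point with parameter `t` of a parametrized line. -/
def linePoint {A : Type} [CommRing A] (p : LineParam → A) (t : A) : Fin 3 → A :=
  fun i => p (.inl (i, 0)) + p (.inl (i, 1)) * t

/-- The value at `x` of the affine form. -/
def lineForm {A : Type} [CommRing A] (p : LineParam → A) (x : Fin 3 → A) : A :=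
  p (.inr none) + ∑ i, p (.inr (some i)) * x i

lemma map_linePoint {A B : Type} [CommRing A] [CommRing B] (φ : A →+* B) (p : LineParam → A)
    (t : A) : φ ∘ linePoint p t = linePoint (φ ∘ p) (φ t) := by
  ext i
  simp [linePoint]

lemma map_lineForm {A B : Type} [CommRing A] [CommRing B] (φ : A →+* B) (p : LineParam → A)
    (x : Fin 3 → A) : φ (lineForm p x) = lineForm (φ ∘ p) (φ ∘ x) := by
  simp [lineForm]

/-- The parametrization `t ↦ t eⱼ` together with the affine form `c + xᵢ`. -/
def axisParam {A : Type} [CommRing A] (i j : Fin 3) (c : A) : LineParam → A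
  | .inl (l, s) => if l = j ∧ s = 1 then 1 else 0
  | .inr none => c
  | .inr (some l) => if l = i then 1 else 0

lemma linePoint_axisParam {A : Type} [CommRing A] (i j : Fin 3) (c t : A) :
    linePoint (axisParam i j c) t = fun l => if l = j then t else 0 := by
  ext l
  simp [linePoint, axisParam]

lemma lineForm_axisParam {A : Type} [CommRing A] (i j : Fin 3) (c : A) (x : Fin 3 → A) :
    lineForm (axisParam i j c) x = c + x i := by
  simp [lineForm, axisParam]

/-- A self-map of affine `3`-space on the points with values in `k`-algebras. -/
abbrev PolyMap (k : Type) [Field k] : Type 1 :=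
  ∀ (A : Type) [CommRing A] [Algebra k A], (Fin 3 → A) → Fin 3 → A

/-- The map is functorial in the algebra. -/
def PolyMap.IsNatural (ψ : PolyMap k) : Prop :=
  ∀ (A B : Type) [CommRing A] [CommRing B] [Algebra k A] [Algebra k B] (φ : A →ₐ[k] B)
    (x : Fin 3 → A), φ ∘ ψ A x = ψ B (φ ∘ x)

/-- The map has degree at most `D`. -/
def PolyMap.DegreeLE (ψ : PolyMap k) (D : ℕ) : Prop :=
  ∀ (S : Type) [CommRing S] [Algebra k S] (x : Fin 3 → Polynomial S),
    (∀ i, (x i).natDegree ≤ 1) → ∀ i, (ψ (Polynomial S) x i).natDegree ≤ D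

open Polynomial in
/-- The number of points of a generic parametrized line mapped by `ψ` into a generic plane. -/
lemma exists_generic_line_param [CharZero k] [IsAlgClosed k] {ψ : PolyMap k} (hψ : ψ.IsNatural)
    {D : ℕ} (hD : 0 < D) (hdeg : ψ.DegreeLE D) (i j : Fin 3)
    (htop : (ψ k[X] (fun l => if l = j then X else 0) i).natDegree = D) :
    ∃ Ψ : MvPolynomial LineParam k, (∃ c, MvPolynomial.eval (axisParam i j c) Ψ ≠ 0) ∧
      ∀ p : LineParam → k, MvPolynomial.eval p Ψ ≠ 0 →
        {t : k | lineForm p (ψ k (linePoint p t)) = 0}.encard = D := by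
  set S := MvPolynomial LineParam k with hS
  let P : LineParam → S[X] := fun s => C (MvPolynomial.X s)
  -- The universal restriction: its coefficients are polynomials in the parameters, and naturality
  -- of ψ identifies its specialisations with the restrictions to actual lines.
  let Q : S[X] := lineForm P (ψ S[X] (linePoint P X))
  let ev (p : LineParam → k) : S[X] →ₐ[k] k[X] := mapAlgHom (MvPolynomial.aeval p)
  have hev (p : LineParam → k) : (Q.map (MvPolynomial.eval p)) =
      lineForm (fun s => C (p s)) (ψ k[X] (linePoint (fun s => C (p s)) X)) := by
    have h1 : Q.map (MvPolynomial.eval p) = (ev p : S[X] →+* k[X]) Q := by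
      simp only [ev, RingHom.coe_coe, coe_mapAlgHom]
      rfl
    have hP : ((ev p : S[X] →+* k[X]) ∘ P) = fun s => C (p s) := by
      ext s : 1
      simp only [ev, P, Function.comp_apply, RingHom.coe_coe, coe_mapAlgHom, map_C]
      exact congrArg C (MvPolynomial.aeval_X p s)
    have hX : (ev p : S[X] →+* k[X]) X = X := by simp [ev]
    rw [h1]
    simp only [Q]
    rw [map_lineForm, hP]
    congr 1
    rw [← hP, ← hX, ← map_linePoint]
    exact hψ _ _ (ev p) _
  have hQdeg : Q.natDegree ≤ D := by
    have h1 : ∀ l, (linePoint P X l).natDegree ≤ 1 := fun l => by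
      simp only [linePoint, P]
      compute_degree
    have h2 := hdeg S (linePoint P X) h1
    simp only [Q, lineForm, P]
    refine (natDegree_add_le _ _).trans (max_le (by simp) ?_)
    exact natDegree_sum_le_of_forall_le _ _ fun l _ => (natDegree_C_mul_le _ _).trans (h2 l)
  -- The factors ask for exact degree D and for simple roots. With the formal degrees D and D - 1
  -- fixed, the resultant commutes with specialisation.
  refine ⟨Q.coeff D * Q.resultant (derivative Q) D (D - 1), ?_, fun p hp => ?_⟩
  · obtain ⟨c, hc⟩ := exists_translate_simple_roots (htop ▸ hD)
    refine ⟨c, ?_⟩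
    have hmap : Q.map (MvPolynomial.eval (axisParam i j c)) =
        C c + ψ k[X] (fun l => if l = j then X else 0) i := by
      have : (fun s => C (axisParam i j c s)) = axisParam i j (C c : k[X]) := by
        ext s : 1
        rcases s with ⟨l, s⟩ | _ | l <;> simp [axisParam, apply_ite]
      rw [hev, this, linePoint_axisParam, lineForm_axisParam]
    have hnd : (C c + ψ k[X] (fun l => if l = j then X else 0) i).natDegree = D := by
      rw [natDegree_C_add, htop]
    rw [map_mul, ← resultant_map_map, ← derivative_map, ← coeff_map, hmap]
    have hne : (C c + ψ k[X] (fun l => if l = j then X else 0) i) ≠ 0 := by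
      intro h
      rw [h] at hnd
      simp at hnd
      omega
    refine mul_ne_zero ?_ ?_
    · rw [← hnd]
      exact leadingCoeff_ne_zero.2 hne
    · have := resultant_derivative_ne_zero_of_simple_roots hne hc
      rwa [hnd] at this
  · rw [map_mul, ← resultant_map_map, ← derivative_map, ← coeff_map] at hp
    have h := encard_zeros_eq_of_resultant_ne_zero (natDegree_map_le.trans hQdeg)
      (left_ne_zero_of_mul hp) (right_ne_zero_of_mul hp)
    rw [← h]
    congr 1
    ext t
    have hP : (evalRingHom t) ∘ (fun s => C (p s)) = p := by
      ext s
      simp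
    have h3 : eval t (Q.map (MvPolynomial.eval p)) = lineForm p (ψ k (linePoint p t)) := by
      rw [hev, ← coe_evalRingHom, map_lineForm, hP]
      congr 1
      have h4 := hψ _ _ (aeval t : k[X] →ₐ[k] k) (linePoint (fun s => C (p s)) X)
      have h5 : ⇑(aeval t : k[X] →ₐ[k] k) = evalRingHom t := by
        ext r
        simp
      rw [h5, map_linePoint, hP] at h4
      simpa using h4
    simp only [Set.mem_ofPred_eq, h3]

/-- The affine form given by row `r` of the coefficients `a`, with the coordinates listed in the
order given by `e`. -/
lemma affineForm_eq_sum_perm (a : Fin 3 × Option (Fin 3) → Qbar) (r : Fin 3)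
    (e : Equiv.Perm (Fin 3)) (x : Fin 3 → Qbar) :
    affineForm a r x = a (r, none) + (a (r, some (e 0)) * x (e 0) + a (r, some (e 1)) * x (e 1) +
      a (r, some (e 2)) * x (e 2)) := by
  rw [affineForm, ← Equiv.sum_comp e, Fin.sum_univ_three]

/-- The numerators of the coordinates of the parametrization, obtained by Cramer's rule, of the
line cut out by the forms of rows `r 1` and `r 2`. -/
noncomputable def cramerParam (r e : Equiv.Perm (Fin 3)) :
    LineParam → MvPolynomial (Fin 3 × Option (Fin 3)) Qbar :=
  let X (i : Fin 3) (l : Option (Fin 3)) : MvPolynomial (Fin 3 × Option (Fin 3)) Qbar :=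
    MvPolynomial.X (r i, l)
  let Δ := X 1 (some (e 1)) * X 2 (some (e 2)) - X 2 (some (e 1)) * X 1 (some (e 2))
  fun
  | .inl (i, s) =>
    let o : Option (Fin 3) := if s = 0 then none else some (e 0)
    if i = e 0 then (if s = 0 then 0 else Δ)
    else if i = e 1 then X 2 o * X 1 (some (e 2)) - X 1 o * X 2 (some (e 2))
    else X 1 o * X 2 (some (e 1)) - X 2 o * X 1 (some (e 1))
  -- The factor Δ compensates for the later division of all parameters by Δ.
  | .inr o => X 0 o * Δ

/-- The number of points of the line cut out by the forms of rows `r 1` and `r 2` that `ψ` maps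
into the plane given by row `r 0`, for generic coefficients. -/
lemma exists_generic_line {ψ : PolyMap Qbar} (hψ : ψ.IsNatural)
    {D : ℕ} (hD : 0 < D) (hdeg : ψ.DegreeLE D) (r e : Equiv.Perm (Fin 3)) (i : Fin 3)
    (htop : (ψ (Polynomial Qbar) (fun l => if l = e 0 then Polynomial.X else 0) i).natDegree = D) :
    ∃ Φ : MvPolynomial (Fin 3 × Option (Fin 3)) Qbar, Φ ≠ 0 ∧
      ∀ a : Fin 3 × Option (Fin 3) → Qbar, MvPolynomial.eval a Φ ≠ 0 →
        {x : Fin 3 → Qbar | affineForm a (r 0) (ψ Qbar x) = 0 ∧ affineForm a (r 1) x = 0 ∧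
          affineForm a (r 2) x = 0}.encard = D := by
  obtain ⟨Ψ, ⟨c, hc⟩, hΨ⟩ := exists_generic_line_param hψ hD hdeg i (e 0) htop
  set Δ : MvPolynomial (Fin 3 × Option (Fin 3)) Qbar :=
    MvPolynomial.X (r 1, some (e 1)) * MvPolynomial.X (r 2, some (e 2)) -
      MvPolynomial.X (r 2, some (e 1)) * MvPolynomial.X (r 1, some (e 2)) with hΔ
  obtain ⟨d, Φ, hΦ⟩ := exists_clear_denominators Δ (cramerParam r e) Ψ
  have e01 : e 0 ≠ e 1 := by simp
  have e02 : e 0 ≠ e 2 := by simp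
  have e12 : e 1 ≠ e 2 := by simp
  refine ⟨Δ * Φ, ?_, fun a ha => ?_⟩
  · have r01 : r 0 ≠ r 1 := by simp
    have r02 : r 0 ≠ r 2 := by simp
    have r12 : r 1 ≠ r 2 := by simp
    -- The special member: rows r 1 and r 2 are the coordinates e 1 and e 2, which cut out the axis
    -- e 0 with Δ = 1, and row r 0 is c + xᵢ.
    let a : Fin 3 × Option (Fin 3) → Qbar := fun s =>
      if s.1 = r 0 then axisParam i (e 0) c (.inr s.2)
      else if s.1 = r 1 then (if s.2 = some (e 1) then 1 else 0)
      else (if s.2 = some (e 2) then 1 else 0)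
    have hΔa : MvPolynomial.eval a Δ = 1 := by
      simp [Δ, a, r01.symm, r02.symm, r12.symm, e12]
    have hpar : (fun s => MvPolynomial.eval a (cramerParam r e s) / MvPolynomial.eval a Δ) =
        axisParam i (e 0) c := by
      ext s
      rw [hΔa, div_one]
      obtain ⟨l, s⟩ | o := s
      · obtain ⟨l, rfl⟩ := e.surjective l
        fin_cases l <;> fin_cases s <;>
          simp [cramerParam, axisParam, a, r01.symm, r02.symm, r12.symm, e12, e01, e02, e01.symm,
            e02.symm, e12.symm]
      · have : MvPolynomial.eval a (cramerParam r e (.inr o)) =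
            a (r 0, o) * MvPolynomial.eval a Δ := by simp [cramerParam, Δ]
        rw [this, hΔa]
        simp [a]
    intro h0
    have h1 : MvPolynomial.eval a (Δ * Φ) = 0 := by rw [h0, map_zero]
    rw [map_mul, hΦ a (by rw [hΔa]; exact one_ne_zero), hpar, hΔa] at h1
    simp only [one_pow, one_mul] at h1
    exact hc h1
  · rw [map_mul] at ha
    have hΔa := left_ne_zero_of_mul ha
    have hΦa := right_ne_zero_of_mul ha
    rw [hΦ a hΔa] at hΦa
    set p : LineParam → Qbar :=
      fun s => MvPolynomial.eval a (cramerParam r e s) / MvPolynomial.eval a Δ with hp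
    rw [← hΨ p (right_ne_zero_of_mul hΦa)]
    have hform (x) : lineForm p x = affineForm a (r 0) x := by
      have hinr (o) : p (.inr o) = a (r 0, o) := by
        simp only [hp]
        rw [show MvPolynomial.eval a (cramerParam r e (.inr o)) =
            a (r 0, o) * MvPolynomial.eval a Δ by simp [cramerParam, Δ], mul_div_cancel_right₀ _ hΔa]
      simp [lineForm, affineForm, hinr]
    have hΔv : MvPolynomial.eval a Δ = a (r 1, some (e 1)) * a (r 2, some (e 2)) -
      a (r 2, some (e 1)) * a (r 1, some (e 2)) := by simp [Δ]
    have hp0 (t) : linePoint p t (e 0) = t := by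
      have h1 : p (.inl (e 0, 0)) = 0 := by simp [hp, cramerParam]
      have h2 : p (.inl (e 0, 1)) = 1 := by
        simp only [hp]
        rw [show MvPolynomial.eval a (cramerParam r e (.inl (e 0, 1))) =
            MvPolynomial.eval a Δ by simp [cramerParam, Δ], div_self hΔa]
      simp [linePoint, h1, h2]
    have hp1 (t) : linePoint p t (e 1) * MvPolynomial.eval a Δ =
        (a (r 2, none) + a (r 2, some (e 0)) * t) * a (r 1, some (e 2)) -
        (a (r 1, none) + a (r 1, some (e 0)) * t) * a (r 2, some (e 2)) := by
      simp only [linePoint, hp]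
      field_simp
      simp [cramerParam, e01.symm]
      ring
    have hp2 (t) : linePoint p t (e 2) * MvPolynomial.eval a Δ =
        (a (r 1, none) + a (r 1, some (e 0)) * t) * a (r 2, some (e 1)) -
        (a (r 2, none) + a (r 2, some (e 0)) * t) * a (r 1, some (e 1)) := by
      simp only [linePoint, hp]
      field_simp
      simp [cramerParam, e02.symm, e12.symm]
      ring
    have hinj : Function.Injective (linePoint p) := fun t t' h => by
      rw [← hp0 t, ← hp0 t', h]
    rw [← hinj.encard_image]
    congr 1
    ext x
    simp only [Set.mem_ofPred_eq, Set.mem_image, hform]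
    constructor
    · rintro ⟨h0, h1, h2⟩
      have hx : linePoint p (x (e 0)) = x := by
        rw [affineForm_eq_sum_perm a _ e] at h1 h2
        ext l
        obtain ⟨l, rfl⟩ := e.surjective l
        fin_cases l
        · exact hp0 _
        · refine mul_right_cancel₀ hΔa ((hp1 _).trans ?_)
          simp only [hΔv, Fin.mk_one]
          linear_combination a (r 1, some (e 2)) * h2 - a (r 2, some (e 2)) * h1
        · refine mul_right_cancel₀ hΔa ((hp2 _).trans ?_)
          simp only [hΔv, Fin.reduceFinMk]
          linear_combination a (r 2, some (e 1)) * h1 - a (r 1, some (e 1)) * h2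
      exact ⟨x (e 0), by rwa [hx], hx⟩
    · rintro ⟨t, ht, rfl⟩
      refine ⟨ht, ?_, ?_⟩ <;> rw [affineForm_eq_sum_perm a _ e, hp0] <;>
        refine mul_right_cancel₀ hΔa ?_
      · linear_combination a (r 1, some (e 1)) * hp1 t + a (r 1, some (e 2)) * hp2 t +
          (a (r 1, none) + a (r 1, some (e 0)) * t) * hΔv
      · linear_combination a (r 2, some (e 1)) * hp1 t + a (r 2, some (e 2)) * hp2 t +
          (a (r 2, none) + a (r 2, some (e 0)) * t) * hΔv

end GenericLine

end AffineDyn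

namespace AffineDyn

/-! ### The dynamical degrees of `f` -/

lemma onPoints_f (P : Fin 3 → Qbar) :
    onPoints f P = ![P 1, P 0 + P 1 - P 1 ^ 3, 2 * P 2 - P 1] := by
  ext i
  fin_cases i <;> simp [onPoints, f]

/-- The map `f` on points with values in an algebra. -/
def fMap : PolyMap Qbar := fun _ _ _ x => ![x 1, x 0 + x 1 - x 1 ^ 3, 2 * x 2 - x 1]

/-- The inverse of `f` on points with values in an algebra. -/
noncomputable def fInvMap : PolyMap Qbar := fun A _ _ x =>
  ![x 1 - x 0 + x 0 ^ 3, x 0, algebraMap Qbar A (1 / 2) * (x 2 + x 0)]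

/-- The iterates of a self-map of affine `3`-space. -/
def PolyMap.iterate {k : Type} [Field k] (ψ : PolyMap k) (n : ℕ) : PolyMap k :=
  fun A _ _ => (ψ A)^[n]

lemma PolyMap.IsNatural.iterate {k : Type} [Field k] {ψ : PolyMap k} (hψ : ψ.IsNatural) (n : ℕ) :
    (ψ.iterate n).IsNatural := by
  intro A B _ _ _ _ φ x
  induction n with
  | zero => rfl
  | succ n ih =>
    simp only [PolyMap.iterate, Function.iterate_succ_apply'] at ih ⊢
    rw [hψ, ih]

lemma isNatural_fMap : fMap.IsNatural := by
  intro A B _ _ _ _ φ x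
  ext i
  fin_cases i <;> simp [fMap, map_ofNat]

lemma isNatural_fInvMap : fInvMap.IsNatural := by
  intro A B _ _ _ _ φ x
  ext i
  fin_cases i
  · simp [fInvMap]
  · simp [fInvMap]
  · simp only [fInvMap, Function.comp_apply, Fin.reduceFinMk, Matrix.cons_val, map_mul, map_add,
      AlgHom.commutes]

lemma fMap_eq_onPoints : fMap Qbar = onPoints f := by
  ext1 P
  rw [onPoints_f]
  rfl

lemma fInvMap_fMap (x : Fin 3 → Qbar) : fInvMap Qbar (fMap Qbar x) = x := by
  ext i
  fin_cases i <;> (simp [fMap, fInvMap]; try ring)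

lemma fMap_fInvMap (x : Fin 3 → Qbar) : fMap Qbar (fInvMap Qbar x) = x := by
  ext i
  fin_cases i <;> (simp [fMap, fInvMap]; try ring)

open Polynomial

lemma natDegree_cubic_le {S : Type} [CommRing S] {u v w : S[X]} {d : ℕ} (hu : u.natDegree ≤ d)
    (hv : v.natDegree ≤ d) (hw : w.natDegree ≤ d) : (u + v + w ^ 3).natDegree ≤ 3 * d :=
  (natDegree_add_le _ _).trans (max_le ((natDegree_add_le _ _).trans
    (max_le (by omega) (by omega))) (natDegree_pow_le.trans (by gcongr)))

lemma natDegree_fMap_iterate_le {S : Type} [CommRing S] [Algebra Qbar S] (x : Fin 3 → S[X])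
    (hx : ∀ i, (x i).natDegree ≤ 1) (n : ℕ) (i : Fin 3) :
    (fMap.iterate n S[X] x i).natDegree ≤ 3 ^ n := by
  induction n generalizing i with
  | zero => simpa [PolyMap.iterate] using hx i
  | succ n ih =>
    rw [PolyMap.iterate, Function.iterate_succ_apply']
    change (fMap S[X] (fMap.iterate n S[X] x) i).natDegree ≤ _
    set u := fMap.iterate n S[X] x
    have hle : 3 ^ n ≤ 3 ^ (n + 1) := Nat.pow_le_pow_right (by norm_num) n.le_succ
    fin_cases i
    · exact (ih 1).trans hle
    · have h := natDegree_cubic_le (ih 0) (ih 1) ((natDegree_neg (u 1)).trans_le (ih 1))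
      rw [pow_succ, mul_comm]
      convert h using 2
      simp only [fMap, Fin.mk_one, Matrix.cons_val]
      ring
    · refine (natDegree_sub_le _ _).trans (max_le ?_ ((ih 1).trans hle))
      have : (2 : S[X]) * u 2 = u 2 + u 2 := two_mul _
      rw [this]
      exact (natDegree_add_le _ _).trans (max_le ((ih 2).trans hle) ((ih 2).trans hle))

lemma natDegree_fInvMap_iterate_le {S : Type} [CommRing S] [Algebra Qbar S] (x : Fin 3 → S[X])
    (hx : ∀ i, (x i).natDegree ≤ 1) (n : ℕ) (i : Fin 3) :
    (fInvMap.iterate n S[X] x i).natDegree ≤ 3 ^ n := by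
  induction n generalizing i with
  | zero => simpa [PolyMap.iterate] using hx i
  | succ n ih =>
    rw [PolyMap.iterate, Function.iterate_succ_apply']
    change (fInvMap S[X] (fInvMap.iterate n S[X] x) i).natDegree ≤ _
    set u := fInvMap.iterate n S[X] x
    have hle : 3 ^ n ≤ 3 ^ (n + 1) := Nat.pow_le_pow_right (by norm_num) n.le_succ
    fin_cases i
    · have h := natDegree_cubic_le (ih 1) ((natDegree_neg (u 0)).trans_le (ih 0)) (ih 0)
      rw [pow_succ, mul_comm]
      convert h using 2
      simp only [fInvMap, Fin.zero_eta, Matrix.cons_val]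
      ring
    · exact (ih 0).trans hle
    · simp only [fInvMap, Fin.reduceFinMk, Matrix.cons_val]
      rw [Polynomial.algebraMap_apply]
      refine (natDegree_C_mul_le _ _).trans ((natDegree_add_le _ _).trans (max_le ?_ ?_))
      exacts [(ih 2).trans hle, (ih 0).trans hle]

lemma natDegree_cubic_eq {k : Type} [Field k] {u w : k[X]} (hw : 0 < w.natDegree)
    (hu : u.natDegree ≤ w.natDegree) : (u + w ^ 3).natDegree = 3 * w.natDegree := by
  have h3 : (w ^ 3).natDegree = 3 * w.natDegree := natDegree_pow _ _
  rw [natDegree_add_eq_right_of_natDegree_lt (by omega), h3]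

/-- Along the y-axis the cube dominates the linear terms at every step, so the bound 3ⁿ is attained.
-/
lemma natDegree_fMap_iterate_axis (n : ℕ) :
    (fMap.iterate n Qbar[X] (fun l => if l = 1 then X else 0) 1).natDegree = 3 ^ n := by
  induction n with
  | zero => simp [PolyMap.iterate]
  | succ n ih =>
    have h0 := natDegree_fMap_iterate_le (S := Qbar) (fun l => if l = 1 then X else 0)
      (fun l => by split_ifs <;> simp) n 0
    rw [PolyMap.iterate, Function.iterate_succ_apply']
    change (fMap Qbar[X] (fMap.iterate n Qbar[X] _) 1).natDegree = _
    set u := fMap.iterate n Qbar[X] fun l => if l = 1 then X else 0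
    have hw : (-u 1).natDegree = 3 ^ n := by rw [natDegree_neg, ih]
    have h := natDegree_cubic_eq (u := u 0 + u 1) (w := -u 1) (by rw [hw]; positivity)
      (by rw [hw]; exact (natDegree_add_le _ _).trans (max_le h0 ih.le))
    rw [hw] at h
    rw [pow_succ, mul_comm, ← h]
    congr 1
    simp only [fMap, Matrix.cons_val]
    ring

lemma natDegree_fInvMap_iterate_axis (n : ℕ) :
    (fInvMap.iterate n Qbar[X] (fun l => if l = 0 then X else 0) 0).natDegree = 3 ^ n := by
  induction n with
  | zero => simp [PolyMap.iterate]
  | succ n ih =>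
    have h0 := natDegree_fInvMap_iterate_le (S := Qbar) (fun l => if l = 0 then X else 0)
      (fun l => by split_ifs <;> simp) n 1
    rw [PolyMap.iterate, Function.iterate_succ_apply']
    change (fInvMap Qbar[X] (fInvMap.iterate n Qbar[X] _) 0).natDegree = _
    set u := fInvMap.iterate n Qbar[X] fun l => if l = 0 then X else 0
    have h := natDegree_cubic_eq (u := u 1 - u 0) (w := u 0) (by rw [ih]; positivity)
      (by rw [ih]; exact (natDegree_sub_le _ _).trans (max_le h0 ih.le))
    rw [ih] at h
    rw [pow_succ, mul_comm, ← h]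
    simp only [fInvMap, Matrix.cons_val]

lemma hasDegree_one (n : ℕ) : HasDegree (onPoints f)^[n] 1 (3 ^ n) := by
  obtain ⟨Φ, hΦ, h⟩ := exists_generic_line (isNatural_fMap.iterate n) (D := 3 ^ n) (by positivity)
    (fun S _ _ x hx => natDegree_fMap_iterate_le x hx n) 1 (Equiv.swap 0 1) 1
    (natDegree_fMap_iterate_axis n)
  refine ⟨Φ, hΦ, fun a ha => ?_⟩
  rw [← h a ha]
  congr 1
  ext x
  simp [Fin.forall_fin_succ, PolyMap.iterate, fMap_eq_onPoints]

/-- The substitution y = fⁿ(x) turns the count into that of the points of a line (rows 0 and 1)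
which f⁻ⁿ sends into a plane (row 2), that is, the first degree of f⁻ⁿ. -/
lemma hasDegree_two (n : ℕ) : HasDegree (onPoints f)^[n] 2 (3 ^ n) := by
  obtain ⟨Φ, hΦ, h⟩ := exists_generic_line (isNatural_fInvMap.iterate n) (D := 3 ^ n)
    (by positivity) (fun S _ _ x hx => natDegree_fInvMap_iterate_le x hx n) (Equiv.swap 0 2) 1 0
    (natDegree_fInvMap_iterate_axis n)
  refine ⟨Φ, hΦ, fun a ha => ?_⟩
  have hr : Function.LeftInverse (onPoints f)^[n] (fInvMap.iterate n Qbar) := by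
    rw [← fMap_eq_onPoints]
    exact Function.LeftInverse.iterate fMap_fInvMap n
  have hl : Function.LeftInverse (fInvMap.iterate n Qbar) (onPoints f)^[n] := by
    rw [← fMap_eq_onPoints]
    exact Function.LeftInverse.iterate fInvMap_fMap n
  have hs : Equiv.swap (0 : Fin 3) 2 1 = 1 := by decide
  rw [← h a ha, ← hl.injective.encard_image]
  congr 1
  ext x
  constructor
  · rintro ⟨y, hy, rfl⟩
    simp [Fin.forall_fin_succ] at hy
    simp [hl y, hs, hy]
  · intro hx
    refine ⟨fInvMap.iterate n Qbar x, ?_, hr x⟩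
    simp [hs] at hx
    simp [Fin.forall_fin_succ, hr x, hx]

lemma hasDynamicalDegree_of_pow {N : ℕ} {φ : (Fin N → Qbar) → (Fin N → Qbar)} {p d : ℕ}
    (h : ∀ n, HasDegree φ^[n] p (d ^ n)) : HasDynamicalDegree φ p d := by
  refine ⟨fun n => d ^ n, h, tendsto_const_nhds.congr' ?_⟩
  filter_upwards [eventually_ne_atTop 0] with n hn
  rw [Nat.cast_pow, one_div, Real.pow_rpow_inv_natCast (Nat.cast_nonneg d) hn]

end AffineDyn

namespace AffineDyn

/-- A subalgebra of the functions on a finite type that separates the points is everything. -/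
lemma adjoin_eq_top_of_separates {k T : Type*} [Field k] [Fintype T] {J : Type*} (x : J → T → k)
    (hsep : ∀ P Q : T, P ≠ Q → ∃ i, x i P ≠ x i Q) :
    Algebra.adjoin k (Set.range x) = ⊤ := by
  classical
  set S := Algebra.adjoin k (Set.range x)
  have hmem (P Q : T) (hPQ : P ≠ Q) : ∃ u ∈ S, u P = 1 ∧ u Q = 0 := by
    obtain ⟨i, hi⟩ := hsep P Q hPQ
    refine ⟨(x i P - x i Q)⁻¹ • (x i - algebraMap k (T → k) (x i Q)), ?_, ?_, ?_⟩
    · exact S.smul_mem (S.sub_mem (Algebra.subset_adjoin (Set.mem_range_self i))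
        (S.algebraMap_mem _)) _
    · simp [inv_mul_cancel₀ (sub_ne_zero.2 hi)]
    · simp
  choose! u hu hu1 hu0 using hmem
  have hsingle (P : T) : (Pi.single P 1 : T → k) ∈ S := by
    have : (Pi.single P 1 : T → k) = ∏ Q ∈ Finset.univ.erase P, u P Q := by
      ext Q
      rw [Finset.prod_apply]
      by_cases hQ : Q = P
      · subst hQ
        rw [Finset.prod_eq_one fun Z hZ => hu1 Q Z (Finset.ne_of_mem_erase hZ).symm]
        simp
      · rw [Finset.prod_eq_zero (f := fun Z => u P Z Q)
          (Finset.mem_erase.2 ⟨hQ, Finset.mem_univ Q⟩) (hu0 P Q (Ne.symm hQ))]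
        simp [hQ]
    rw [this]
    exact prod_mem fun Q hQ => hu P Q (Finset.ne_of_mem_erase hQ).symm
  refine eq_top_iff.2 fun w _ => ?_
  have hw : w = ∑ P, w P • (Pi.single P 1 : T → k) := by
    ext Q
    simp [Finset.sum_apply, Pi.single_apply]
  rw [hw]
  exact sum_mem fun P _ => S.smul_mem (hsingle P) _

/-! ### Algebras generated by elements whose cubes are linear combinations of the generators -/

section CubicSystem

variable {R A ι : Type*} [CommRing R] [CommRing A] [Algebra R A] [Fintype ι]

/-- Replacing a factor xᵢ³ by a linear combination of generators lowers the total degree by two, so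
induction on the total degree applies. -/
lemma prod_pow_mem_span_of_cube_mem (x : ι → A)
    (hx : ∀ i, x i ^ 3 ∈ Submodule.span R (Set.range x)) (β : ι → ℕ) :
    ∏ i, x i ^ β i ∈ Submodule.span R (Set.range fun α : ι → Fin 3 => ∏ i, x i ^ (α i : ℕ)) := by
  classical
  induction hd : ∑ i, β i using Nat.strong_induction_on generalizing β with
  | _ d ih =>
    by_cases hβ : ∀ i, β i < 3
    · exact Submodule.subset_span ⟨fun i => ⟨β i, hβ i⟩, rfl⟩
    · push Not at hβ
      obtain ⟨i, hi⟩ := hβ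
      obtain ⟨γ, rfl⟩ : ∃ γ : ι → ℕ, β = γ + Pi.single i 3 := by
        refine ⟨β - Pi.single i 3, funext fun j => ?_⟩
        by_cases hj : j = i
        · subst hj
          simp [hi]
        · simp [hj]
      have hprod (δ ε : ι → ℕ) :
          ∏ j, x j ^ (δ + ε) j = (∏ j, x j ^ δ j) * ∏ j, x j ^ ε j := by
        simp [pow_add, Finset.prod_mul_distrib]
      have hsingle (j : ι) (c : ℕ) : ∏ l, x l ^ (Pi.single j c : ι → ℕ) l = x j ^ c := by
        rw [Finset.prod_eq_single j] <;> simp +contextual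
      have hsum (j : ι) (c : ℕ) : ∑ l, (γ + Pi.single j c : ι → ℕ) l = ∑ l, γ l + c := by
        simp [Finset.sum_add_distrib]
      rw [hsum] at hd
      rw [hprod, hsingle]
      refine Submodule.span_induction (p := fun w _ => (∏ j, x j ^ γ j) * w ∈ _) ?_ ?_ ?_ ?_ (hx i)
      · rintro _ ⟨j, rfl⟩
        have h := ih (∑ l, γ l + 1) (by omega) (γ + Pi.single j 1) (hsum j 1)
        rwa [hprod, hsingle, pow_one] at h
      · simp
      · intro u v _ _ hu hv
        rw [mul_add]
        exact add_mem hu hv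
      · intro c u _ hu
        rw [mul_smul_comm]
        exact Submodule.smul_mem _ _ hu

lemma toSubmodule_adjoin_eq_span_of_cube_mem (x : ι → A)
    (hx : ∀ i, x i ^ 3 ∈ Submodule.span R (Set.range x)) :
    Subalgebra.toSubmodule (Algebra.adjoin R (Set.range x)) =
      Submodule.span R (Set.range fun α : ι → Fin 3 => ∏ i, x i ^ (α i : ℕ)) := by
  classical
  refine le_antisymm ?_ ?_
  · rw [Algebra.adjoin_eq_span, Submodule.span_le]
    intro y hy
    have : ∃ β : ι → ℕ, y = ∏ i, x i ^ β i := by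
      induction hy using Submonoid.closure_induction with
      | mem y hy =>
        obtain ⟨j, rfl⟩ := hy
        refine ⟨Pi.single j 1, ?_⟩
        rw [Finset.prod_eq_single j] <;> simp +contextual
      | one => exact ⟨0, by simp⟩
      | mul y z _ _ hy hz =>
        obtain ⟨β, rfl⟩ := hy
        obtain ⟨γ, rfl⟩ := hz
        exact ⟨β + γ, by simp [pow_add, Finset.prod_mul_distrib]⟩
    obtain ⟨β, rfl⟩ := this
    exact prod_pow_mem_span_of_cube_mem x hx β
  · rw [Submodule.span_le]
    rintro _ ⟨α, rfl⟩
    exact (Algebra.adjoin R (Set.range x)).prod_mem fun i _ =>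
      pow_mem (Algebra.subset_adjoin (Set.mem_range_self i)) _

lemma isIntegral_of_cube_mem (x : ι → A)
    (hx : ∀ i, x i ^ 3 ∈ Submodule.span R (Set.range x)) (i : ι) : IsIntegral R (x i) := by
  refine IsIntegral.of_mem_of_fg (Algebra.adjoin R (Set.range x)) ?_ _
    (Algebra.subset_adjoin (Set.mem_range_self i))
  rw [toSubmodule_adjoin_eq_span_of_cube_mem x hx]
  exact Submodule.fg_span (Set.finite_range _)

/-- A Bézout bound by linear algebra: separation makes the coordinate functions generate all
functions on T, and the reduced monomials span what they generate. -/
lemma card_le_of_cube_mem {k T : Type*} [Field k] [Fintype T] (x : ι → T → k)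
    (hsep : ∀ P Q : T, P ≠ Q → ∃ i, x i P ≠ x i Q)
    (hx : ∀ i, x i ^ 3 ∈ Submodule.span k (Set.range x)) :
    Fintype.card T ≤ 3 ^ Fintype.card ι := by
  classical
  have h := toSubmodule_adjoin_eq_span_of_cube_mem x hx
  rw [adjoin_eq_top_of_separates x hsep, Algebra.top_toSubmodule] at h
  calc Fintype.card T = Module.finrank k (T → k) := (Module.finrank_fintype_fun_eq_card k).symm
    _ = Module.finrank k (⊤ : Submodule k (T → k)) := (finrank_top k _).symm
    _ ≤ Fintype.card (ι → Fin 3) := by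
      rw [h]
      exact finrank_range_le_card _
    _ = 3 ^ Fintype.card ι := by simp

end CubicSystem

/-! ### The plane map `(x, y) ↦ (y, x + y - y³)` -/

/-- The map `(x, y) ↦ (y, x + y - y³)` on the points of the plane with values in a ring. -/
def gMap {A : Type*} [CommRing A] (u : A × A) : A × A := (u.2, u.1 + u.2 - u.2 ^ 3)

section PlaneMap

variable {A : Type*} [CommRing A]

lemma map_gMap_iterate {B : Type*} [CommRing B] (φ : A →+* B) (u : A × A) (n : ℕ) :
    Prod.map φ φ (gMap^[n] u) = gMap^[n] (Prod.map φ φ u) := by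
  induction n with
  | zero => rfl
  | succ n ih =>
    rw [Function.iterate_succ_apply', Function.iterate_succ_apply', ← ih]
    simp [gMap, Prod.map]

lemma fst_gMap_iterate_succ (u : A × A) (n : ℕ) : (gMap^[n + 1] u).1 = (gMap^[n] u).2 := by
  rw [Function.iterate_succ_apply']
  rfl

lemma fst_gMap_iterate_cube (u : A × A) (n : ℕ) :
    (gMap^[n + 1] u).1 ^ 3 =
      (gMap^[n] u).1 + (gMap^[n + 1] u).1 - (gMap^[n + 2] u).1 := by
  rw [fst_gMap_iterate_succ u (n + 1), fst_gMap_iterate_succ u n, Function.iterate_succ_apply']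
  simp [gMap]

lemma fst_gMap_iterate_mod {u : A × A} {n : ℕ} (hu : gMap^[n] u = u) (i : ℕ) :
    (gMap^[i % n] u).1 = (gMap^[i] u).1 := by
  have h : Function.IsPeriodicPt gMap n u := hu
  rw [h.iterate_mod_apply]

/-- The cube of each term of a periodic orbit is a linear combination of the terms. -/
lemma cube_mem_span_of_isPeriodic (R : Type*) [CommRing R] [Algebra R A] {u : A × A} {n : ℕ}
    (hn : 0 < n) (hu : gMap^[n] u = u) (i : Fin n) :
    (gMap^[i] u).1 ^ 3 ∈
      Submodule.span R (Set.range fun j : Fin n => (gMap^[j] u).1) := by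
  have hmem (j : ℕ) : (gMap^[j] u).1 ∈
      Submodule.span R (Set.range fun j : Fin n => (gMap^[j] u).1) :=
    Submodule.subset_span ⟨⟨j % n, Nat.mod_lt j hn⟩, fst_gMap_iterate_mod hu j⟩
  -- Going once around the cycle makes the index a successor, as the cube relation requires.
  have h1 : (gMap^[i] u).1 = (gMap^[i + (n - 1) + 1] u).1 := by
    rw [← fst_gMap_iterate_mod hu (i + (n - 1) + 1), show (i : ℕ) + (n - 1) + 1 = i + n by omega,
      Nat.add_mod_right, Nat.mod_eq_of_lt i.2]
  rw [h1, fst_gMap_iterate_cube]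
  exact sub_mem (add_mem (hmem _) (hmem _)) (hmem _)

lemma isIntegral_of_isPeriodic (R : Type*) [CommRing R] [Algebra R A] {u : A × A} {n : ℕ}
    (hn : 0 < n) (hu : gMap^[n] u = u) : IsIntegral R u.1 ∧ IsIntegral R u.2 := by
  have h (j : ℕ) : IsIntegral R (gMap^[j] u).1 := by
    rw [← fst_gMap_iterate_mod hu]
    exact isIntegral_of_cube_mem (fun j : Fin n => (gMap^[j] u).1)
      (cube_mem_span_of_isPeriodic R hn hu) ⟨j % n, Nat.mod_lt j hn⟩
  exact ⟨h 0, h 1⟩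

/-- The last coordinate of the `n`-th iterate of `f`. -/
lemma onPoints_f_iterate (P : Fin 3 → Qbar) (n : ℕ) :
    (onPoints f)^[n] P = ![(gMap^[n] (P 0, P 1)).1, (gMap^[n] (P 0, P 1)).2,
      2 ^ n * P 2 - ∑ k ∈ Finset.range n, 2 ^ (n - 1 - k) * (gMap^[k] (P 0, P 1)).2] := by
  induction n with
  | zero =>
    ext i
    fin_cases i <;> simp
  | succ n ih =>
    rw [Function.iterate_succ_apply', ih, onPoints_f, Function.iterate_succ_apply']
    ext i
    fin_cases i
    · simp [gMap]
    · simp [gMap]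
    · simp only [Fin.reduceFinMk, Matrix.cons_val, Finset.sum_range_succ]
      have : ∑ k ∈ Finset.range n, (2 : Qbar) ^ (n + 1 - 1 - k) * (gMap^[k] (P 0, P 1)).2 =
          2 * ∑ k ∈ Finset.range n, (2 : Qbar) ^ (n - 1 - k) * (gMap^[k] (P 0, P 1)).2 := by
        rw [Finset.mul_sum]
        refine Finset.sum_congr rfl fun k hk => ?_
        have := Finset.mem_range.1 hk
        rw [show n + 1 - 1 - k = (n - 1 - k) + 1 by omega]
        ring
      rw [this]
      simp
      ring

lemma two_pow_sub_one_ne_zero {n : ℕ} (hn : n ≠ 0) : (2 : Qbar) ^ n - 1 ≠ 0 := by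
  rw [sub_ne_zero]
  exact_mod_cast (Nat.one_lt_two_pow hn).ne'

/-- The n-th iterate is affine in z with slope 2ⁿ, so a periodic plane point has exactly one
periodic z above it when n ≥ 1, with 2ⁿ - 1 as denominator. -/
lemma mem_Per_iff {n : ℕ} (P : Fin 3 → Qbar) :
    P ∈ Per n (onPoints f) ↔ gMap^[n] (P 0, P 1) = (P 0, P 1) ∧
      (2 ^ n - 1) * P 2 =
        ∑ k ∈ Finset.range n, 2 ^ (n - 1 - k) * (gMap^[k] (P 0, P 1)).2 := by
  rw [Per, Set.mem_ofPred_eq, onPoints_f_iterate]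
  constructor
  · intro h
    refine ⟨Prod.ext (congrFun h 0) (congrFun h 1), ?_⟩
    have := congrFun h 2
    simp only [Matrix.cons_val] at this
    linear_combination this
  · rintro ⟨h1, h2⟩
    ext i
    fin_cases i
    · simp [h1]
    · simp [h1]
    · simp only [Fin.reduceFinMk, Matrix.cons_val]
      linear_combination h2

/-- All points of T are treated at once as a single periodic point of g over the product ring of
functions on T. The orbit functions separate T because z is determined by x and y. -/
lemma card_le_of_subset_Per {n : ℕ} (hn : 1 ≤ n) (T : Finset (Fin 3 → Qbar))
    (hT : (T : Set (Fin 3 → Qbar)) ⊆ Per n (onPoints f)) : T.card ≤ 3 ^ n := by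
  have hper (P : T) := (mem_Per_iff P.1).1 (hT P.2)
  have hu : gMap^[n] ((fun P : T => P.1 0, fun P : T => P.1 1) : (T → Qbar) × (T → Qbar)) =
      (fun P : T => P.1 0, fun P : T => P.1 1) := by
    have h (P : T) := map_gMap_iterate (Pi.evalRingHom (fun _ : T => Qbar) P)
      (fun P : T => P.1 0, fun P : T => P.1 1) n
    refine Prod.ext (funext fun P => ?_) (funext fun P => ?_)
    · exact congrArg Prod.fst ((h P).trans (hper P).1)
    · exact congrArg Prod.snd ((h P).trans (hper P).1)
  have hval (P : T) (i : ℕ) :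
      (gMap^[i] ((fun P : T => P.1 0, fun P : T => P.1 1) : (T → Qbar) × (T → Qbar))).1 P =
        (gMap^[i] (P.1 0, P.1 1)).1 :=
    congrArg Prod.fst (map_gMap_iterate (Pi.evalRingHom (fun _ : T => Qbar) P)
      (fun P : T => P.1 0, fun P : T => P.1 1) i)
  have h := card_le_of_cube_mem
    (fun j : Fin n => (gMap^[j] ((fun P : T => P.1 0, fun P : T => P.1 1) :
      (T → Qbar) × (T → Qbar))).1) ?_ (cube_mem_span_of_isPeriodic Qbar hn hu)
  · simpa using h
  · intro P Q hPQ
    by_contra! heq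
    refine hPQ (Subtype.ext ?_)
    have hall (i : ℕ) : (gMap^[i] (P.1 0, P.1 1)).1 = (gMap^[i] (Q.1 0, Q.1 1)).1 := by
      rw [← fst_gMap_iterate_mod (hper P).1, ← fst_gMap_iterate_mod (hper Q).1, ← hval, ← hval]
      exact heq ⟨i % n, Nat.mod_lt i hn⟩
    have h0 : P.1 0 = Q.1 0 := hall 0
    have h1 : P.1 1 = Q.1 1 := hall 1
    have h2 : P.1 2 = Q.1 2 := by
      refine mul_left_cancel₀ (two_pow_sub_one_ne_zero (n := n) (by omega)) ?_
      rw [(hper P).2, (hper Q).2, h0, h1]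
    ext i
    fin_cases i
    exacts [h0, h1, h2]

lemma finite_Per {n : ℕ} (hn : 1 ≤ n) : (Per n (onPoints f)).Finite := by
  by_contra hinf
  obtain ⟨T, hT, hcard⟩ := Set.Infinite.exists_subset_card_eq hinf (3 ^ n + 1)
  have := card_le_of_subset_Per hn T hT
  omega

lemma ncard_Per_le {n : ℕ} (hn : 1 ≤ n) : (Per n (onPoints f)).ncard ≤ 3 ^ n := by
  rw [Set.ncard_eq_toFinset_card _ (finite_Per hn)]
  exact card_le_of_subset_Per hn _ (by simp)

end PlaneMap

end AffineDyn

namespace AffineDyn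

/-! ### The plane map in characteristic three -/

section CharThree

/-- Both sides agree after multiplication by y - 1. The cancellation is done in the domain of
polynomials over `ZMod p`, since R may have zero divisors. -/
lemma geom_sum_eq_sub_one_pow {R : Type*} [Ring R] (p : ℕ) [Fact p.Prime] [CharP R p] (y : R)
    (m : ℕ) : ∑ i ∈ Finset.range (p ^ m), y ^ i = (y - 1) ^ (p ^ m - 1) := by
  have h : ∑ i ∈ Finset.range (p ^ m), (Polynomial.X : Polynomial (ZMod p)) ^ i =
      (Polynomial.X - 1) ^ (p ^ m - 1) := by
    have hne : (Polynomial.X - 1 : Polynomial (ZMod p)) ≠ 0 := Polynomial.X_sub_C_ne_zero 1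
    refine mul_right_cancel₀ hne ?_
    rw [geom_sum_mul, ← pow_succ,
      Nat.sub_add_cancel (Nat.one_le_pow _ _ (Fact.out : p.Prime).pos), sub_pow_char_pow, one_pow]
  let := ZMod.algebra R p
  have h2 := congrArg (Polynomial.aeval y) h
  simpa using h2

variable {R : Type*} [Ring R] [CharP R 3] {M τ : R}

/-- The 3^m-th power is additive on commuting elements; it is applied to both sides of the quadratic
relation. With M = g and τ the Frobenius, the factor 1 - τ^(3^m) kills the points over the field
with 3^(3^m) elements. -/
lemma pow_two_mul_three_pow (hc : Commute M τ) (hM : M * M = 1 + (1 - τ) * M) (m : ℕ) :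
    M ^ (2 * 3 ^ m) = 1 + (1 - τ ^ 3 ^ m) * M ^ 3 ^ m := by
  have : Fact (Nat.Prime 3) := ⟨Nat.prime_three⟩
  have hc1 : Commute (1 - τ) M := (Commute.one_left M).sub_left hc.symm
  rw [pow_mul, pow_two, hM, add_pow_char_pow_of_commute 3 m (Commute.one_left _), one_pow,
    hc1.mul_pow, sub_pow_char_pow_of_commute 3 m (Commute.one_left τ), one_pow]

/-- Pairing consecutive terms leaves a geometric sum in M², which equals (M² - 1)^(3^m - 1) = ((1 -
τ)M)^(3^m - 1); the power of 1 - τ is again a geometric sum, the trace. As 2 = -1, the left side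
gives the numerator of z up to sign. -/
lemma sum_neg_pow_two_mul_three_pow (hc : Commute M τ) (hM : M * M = 1 + (1 - τ) * M) (m : ℕ) :
    ∑ k ∈ Finset.range (2 * 3 ^ m), (-M) ^ k =
      (1 - M) * (M ^ (3 ^ m - 1) * ∑ i ∈ Finset.range (3 ^ m), τ ^ i) := by
  have : Fact (Nat.Prime 3) := ⟨Nat.prime_three⟩
  have hc1 : Commute (1 - τ) M := (Commute.one_left M).sub_left hc.symm
  have heven : Even (3 ^ m - 1) := by
    obtain ⟨r, hr⟩ : Odd (3 ^ m) := Odd.pow (by decide)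
    exact ⟨r, by omega⟩
  have hsplit (N : ℕ) : ∑ k ∈ Finset.range (2 * N), (-M) ^ k =
      (1 - M) * ∑ j ∈ Finset.range N, (M * M) ^ j := by
    induction N with
    | zero => simp
    | succ N ih =>
      rw [show 2 * (N + 1) = 2 * N + 1 + 1 by ring, Finset.sum_range_succ, Finset.sum_range_succ,
        ih, Finset.sum_range_succ, mul_add, pow_succ (-M) (2 * N), pow_mul, neg_sq, pow_two]
      have : Commute ((M * M) ^ N) M := ((Commute.refl M).mul_left (Commute.refl M)).pow_left N
      rw [sub_mul 1 M ((M * M) ^ N), one_mul, mul_neg, this.eq]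
      abel
  rw [hsplit, geom_sum_eq_sub_one_pow 3, hM, add_sub_cancel_left, hc1.mul_pow,
    geom_sum_eq_sub_one_pow 3, ← neg_sub τ 1, heven.neg_pow]
  congr 1
  have hc2 : Commute (τ - 1) M := (hc.symm).sub_left (Commute.one_left M)
  exact (hc2.pow_pow _ _).eq

variable {κ : Type*} [Field κ] [CharP κ 3]

/-- The Frobenius map on the plane. -/
def frobEnd (κ : Type*) [Field κ] [CharP κ 3] : Module.End ℤ (κ × κ) :=
  AddMonoidHom.toIntLinearMap <| AddMonoidHom.mk' (fun u => (u.1 ^ 3, u.2 ^ 3)) fun u v => by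
    have : Fact (Nat.Prime 3) := ⟨Nat.prime_three⟩
    simp [add_pow_char]

/-- The map `(x, y) ↦ (y, x + y - y³)` is additive in characteristic three. -/
def gEnd (κ : Type*) [Field κ] [CharP κ 3] : Module.End ℤ (κ × κ) :=
  AddMonoidHom.toIntLinearMap <| AddMonoidHom.mk' gMap fun u v => by
    have : Fact (Nat.Prime 3) := ⟨Nat.prime_three⟩
    simp only [gMap, Prod.snd_add, Prod.fst_add, add_pow_char, Prod.mk_add_mk, Prod.mk.injEq,
      true_and]
    ring

lemma frobEnd_apply (u : κ × κ) : frobEnd κ u = (u.1 ^ 3, u.2 ^ 3) := rfl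

lemma gEnd_apply (u : κ × κ) : gEnd κ u = gMap u := rfl

instance charP_end : CharP (Module.End ℤ (κ × κ)) 3 := by
  rw [CharP.charP_iff_prime_eq_zero Nat.prime_three]
  refine LinearMap.ext fun u => ?_
  have h3 : (3 : κ) = 0 := CharP.cast_eq_zero κ 3
  have h (a : κ) : 3 • a = 0 := by rw [nsmul_eq_mul]; push_cast; rw [h3, zero_mul]
  rw [Module.End.natCast_apply]
  exact Prod.ext (h u.1) (h u.2)

lemma commute_gEnd_frobEnd : Commute (gEnd κ) (frobEnd κ) := by
  have : Fact (Nat.Prime 3) := ⟨Nat.prime_three⟩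
  refine LinearMap.ext fun u => ?_
  simp only [Module.End.mul_apply, frobEnd_apply, gEnd_apply, gMap, sub_pow_char, add_pow_char]

/-- This is the characteristic equation of the recurrence x_{k+2} = x_k + (1 - τ)x_{k+1}. -/
lemma gEnd_mul_self : gEnd κ * gEnd κ = 1 + (1 - frobEnd κ) * gEnd κ := by
  have : Fact (Nat.Prime 3) := ⟨Nat.prime_three⟩
  refine LinearMap.ext fun u => ?_
  rw [LinearMap.add_apply, Module.End.mul_apply, Module.End.mul_apply,
    LinearMap.sub_apply, Module.End.one_apply, Module.End.one_apply, frobEnd_apply,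
    gEnd_apply, gEnd_apply]
  refine Prod.ext ?_ ?_ <;> simp only [gMap, Prod.fst_add, Prod.snd_add, Prod.fst_sub, Prod.snd_sub]
    <;> ring

lemma frobEnd_pow_apply (u : κ × κ) (i : ℕ) :
    (frobEnd κ ^ i) u = (u.1 ^ 3 ^ i, u.2 ^ 3 ^ i) := by
  induction i with
  | zero => simp
  | succ i ih =>
    rw [pow_succ', Module.End.mul_apply, ih, frobEnd_apply]
    simp only [← pow_mul, ← pow_succ]

lemma gEnd_pow_apply (u : κ × κ) (i : ℕ) : (gEnd κ ^ i) u = gMap^[i] u := by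
  induction i with
  | zero => rfl
  | succ i ih => rw [pow_succ', Module.End.mul_apply, ih, Function.iterate_succ_apply',
      gEnd_apply]

/-- In characteristic three, the points with coordinates in the field with `3 ^ 3 ^ m` elements
are periodic of period `2 * 3 ^ m`. -/
lemma gMap_iterate_eq_self {m : ℕ} {u : κ × κ} (h1 : u.1 ^ 3 ^ 3 ^ m = u.1)
    (h2 : u.2 ^ 3 ^ 3 ^ m = u.2) : gMap^[2 * 3 ^ m] u = u := by
  rw [← gEnd_pow_apply, pow_two_mul_three_pow commute_gEnd_frobEnd gEnd_mul_self]
  have hc : Commute (1 - frobEnd κ ^ 3 ^ m) (gEnd κ ^ 3 ^ m) :=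
    ((Commute.one_left _).sub_left ((commute_gEnd_frobEnd.symm).pow_left _)).pow_right _
  rw [hc.eq, LinearMap.add_apply, Module.End.mul_apply, LinearMap.sub_apply,
    Module.End.one_apply, frobEnd_pow_apply, h1, h2, Prod.mk.eta, sub_self, map_zero, add_zero]

/-- The trace from the field with `3 ^ 3 ^ m` elements to the prime field. -/
def trThree (m : ℕ) (a : κ) : κ := ∑ i ∈ Finset.range (3 ^ m), a ^ 3 ^ i

lemma trThree_pow_three {m : ℕ} {a : κ} (h : a ^ 3 ^ 3 ^ m = a) :
    trThree m a ^ 3 = trThree m a := by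
  have : Fact (Nat.Prime 3) := ⟨Nat.prime_three⟩
  rw [trThree, sum_pow_char 3]
  have h1 : ∀ i, (a ^ 3 ^ i) ^ 3 = a ^ 3 ^ (i + 1) := fun i => by rw [← pow_mul, ← pow_succ]
  simp only [h1]
  have h2 := Finset.sum_range_succ (fun i => a ^ 3 ^ i) (3 ^ m)
  rw [Finset.sum_range_succ'] at h2
  rw [h, pow_zero, pow_one] at h2
  exact add_right_cancel h2

/-- Traces lie in the prime field, where cubing is trivial and g swaps the coordinates. Hence the
even power M^(3^m - 1) acts trivially on the pair of traces and 1 - M produces their difference. -/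
lemma sum_two_pow_mul_gMap_iterate {m : ℕ} {u : κ × κ} (h1 : u.1 ^ 3 ^ 3 ^ m = u.1)
    (h2 : u.2 ^ 3 ^ 3 ^ m = u.2) :
    ∑ k ∈ Finset.range (2 * 3 ^ m), 2 ^ (2 * 3 ^ m - 1 - k) * (gMap^[k] u).2 =
      trThree m u.1 - trThree m u.2 := by
  have hkey := congrArg (fun φ : Module.End ℤ (κ × κ) => (φ u).2)
    (sum_neg_pow_two_mul_three_pow (commute_gEnd_frobEnd (κ := κ)) gEnd_mul_self m)
  have htr : (∑ i ∈ Finset.range (3 ^ m), frobEnd κ ^ i) u = (trThree m u.1, trThree m u.2) := by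
    rw [LinearMap.sum_apply]
    simp only [frobEnd_pow_apply, trThree]
    exact Prod.ext (by simp [Prod.fst_sum]) (by simp [Prod.snd_sum])
  have hswap (c d : κ) (hc : c ^ 3 = c) (hd : d ^ 3 = d) : gMap (c, d) = (d, c) := by
    simp [gMap, hd]
  have hc := trThree_pow_three h1
  have hd := trThree_pow_three h2
  have hpow (j : ℕ) : gMap^[2 * j] (trThree m u.1, trThree m u.2) =
      (trThree m u.1, trThree m u.2) := by
    rw [Function.iterate_mul]
    refine Function.iterate_fixed ?_ j
    simp [hswap _ _ hc hd, hswap _ _ hd hc]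
  obtain ⟨r, hr⟩ : Odd (3 ^ m) := Odd.pow (by decide)
  simp only [Module.End.mul_apply, htr] at hkey
  rw [gEnd_pow_apply, show 3 ^ m - 1 = 2 * r by omega, hpow, LinearMap.sub_apply,
    Module.End.one_apply, gEnd_apply, hswap _ _ hc hd, LinearMap.sum_apply,
    Prod.snd_sum] at hkey
  simp only [Prod.snd_sub] at hkey
  rw [← neg_sub, ← hkey, ← Finset.sum_neg_distrib]
  refine Finset.sum_congr rfl fun k hk => ?_
  have hk := Finset.mem_range.1 hk
  have h2 : (2 : κ) = -1 := by
    have h3 : (3 : κ) = 0 := CharP.cast_eq_zero κ 3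
    linear_combination h3
  rw [h2]
  have hsign : ((-gEnd κ) ^ k) u = (-1 : ℤ) ^ k • gMap^[k] u := by
    rcases Nat.even_or_odd k with hk | hk
    · rw [hk.neg_pow, hk.neg_one_pow, gEnd_pow_apply, one_smul]
    · rw [hk.neg_pow, hk.neg_one_pow, LinearMap.neg_apply, gEnd_pow_apply, neg_one_smul]
  rw [hsign]
  -- The period is even, so n - 1 - k and k have opposite parity.
  have hp : ((-1 : κ) ^ (2 * 3 ^ m - 1 - k)) = -(-1) ^ k := by
    rcases Nat.even_or_odd k with hk | hk
    · rw [hk.neg_one_pow, Odd.neg_one_pow]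
      obtain ⟨s, rfl⟩ := hk
      exact ⟨3 ^ m - 1 - s, by omega⟩
    · rw [hk.neg_one_pow, Even.neg_one_pow, neg_neg]
      obtain ⟨s, rfl⟩ := hk
      exact ⟨3 ^ m - 1 - s, by omega⟩
  rw [hp]
  simp [zsmul_eq_mul]

end CharThree

end AffineDyn

namespace AffineDyn

/-! ### Lifting periodic points from the residue field -/

section Lifting

variable {C : Type*} [NormedField C] [IsUltrametricDist C]

lemma norm_sub_le_max_norm {E : Type*} [SeminormedAddCommGroup E] [IsUltrametricDist E] (u v : E) :
    ‖u - v‖ ≤ max ‖u‖ ‖v‖ := by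
  simpa [sub_eq_add_neg] using IsUltrametricDist.norm_add_le_max u (-v)

instance isUltrametricDist_prod : IsUltrametricDist (C × C) :=
  IsUltrametricDist.isUltrametricDist_of_forall_norm_add_le_max_norm fun u v => max_le
    ((IsUltrametricDist.norm_add_le_max u.1 v.1).trans (max_le_max (norm_fst_le u) (norm_fst_le v)))
    ((IsUltrametricDist.norm_add_le_max u.2 v.2).trans (max_le_max (norm_snd_le u) (norm_snd_le v)))

/-- The linear map `(x, y) ↦ (y, x + y)`. -/
def fibEnd (C : Type*) [CommRing C] : Module.End ℤ (C × C) :=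
  (AddMonoidHom.mk' (fun u => (u.2, u.1 + u.2)) fun u v => by
    refine Prod.ext rfl ?_
    simp only [Prod.fst_add, Prod.snd_add]
    ring).toIntLinearMap

lemma fibEnd_apply {C : Type*} [CommRing C] (u : C × C) : fibEnd C u = (u.2, u.1 + u.2) := rfl

lemma fibEnd_sq (C : Type*) [CommRing C] : fibEnd C ^ 2 = fibEnd C + 1 := by
  refine LinearMap.ext fun u => ?_
  rw [pow_two, Module.End.mul_apply, LinearMap.add_apply, Module.End.one_apply, fibEnd_apply,
    fibEnd_apply]
  refine Prod.ext ?_ ?_ <;> simp only [Prod.fst_add, Prod.snd_add] <;> ring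

lemma norm_aeval_fibEnd_le (p : Polynomial ℤ) (v : C × C) :
    ‖Polynomial.aeval (fibEnd C) p v‖ ≤ ‖v‖ := by
  have hA (w : C × C) : ‖fibEnd C w‖ ≤ ‖w‖ := by
    rw [fibEnd_apply, Prod.norm_mk]
    exact max_le (norm_snd_le w) ((IsUltrametricDist.norm_add_le_max _ _).trans
      (max_le (norm_fst_le w) (norm_snd_le w)))
  have hpow (k : ℕ) (w : C × C) : ‖(fibEnd C ^ k) w‖ ≤ ‖w‖ := by
    induction k with
    | zero => simp
    | succ k ih =>
      rw [pow_succ', Module.End.mul_apply]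
      exact (hA _).trans ih
  induction p using Polynomial.induction_on' with
  | add p q hp hq =>
    rw [map_add, LinearMap.add_apply]
    exact (IsUltrametricDist.norm_add_le_max _ _).trans (max_le hp hq)
  | monomial k c =>
    rw [Polynomial.aeval_monomial, ← Algebra.smul_def, LinearMap.smul_apply,
      ← Int.cast_smul_eq_zsmul C, norm_smul]
    exact (mul_le_of_le_one_left (norm_nonneg _)
      (IsUltrametricDist.norm_intCast_le_one C c)).trans (hpow k v)

/-- The linearization of the plane map has an integral approximate inverse. -/
lemma exists_fibEnd_inverse {C : Type*} [NormedField C] (m : ℕ) : ∃ b r : Polynomial ℤ,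
    (∀ v : C × C, Polynomial.aeval (fibEnd C) b v = 0 → v = 0) ∧
    ∀ v : C × C, Polynomial.aeval (fibEnd C) b ((fibEnd C ^ (2 * 3 ^ m)) v - v) =
      v + Polynomial.aeval (fibEnd C) r ((3 : C) • v) := by
  -- For A = `fibEnd C` one has A² - 1 = A, so A^(2·3^m) - 1 is A^(3^m) modulo 3; its inverse is (A
  -- - 1)^(3^m), because A(A - 1) = 1.
  obtain ⟨s, hs⟩ : ∃ s : Polynomial ℤ, (Polynomial.X ^ 2 - 1 + 1 : Polynomial ℤ) ^ 3 ^ m =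
      (Polynomial.X ^ 2 - 1) ^ 3 ^ m + 1 ^ 3 ^ m + ((3 : ℕ) : Polynomial ℤ) * s := by
    obtain ⟨s, hs⟩ := exists_add_pow_prime_pow_eq Nat.prime_three
      (Polynomial.X ^ 2 - 1 : Polynomial ℤ) 1 m
    exact ⟨(Polynomial.X ^ 2 - 1) * s, by rw [hs]; ring⟩
  set A := fibEnd C
  have hs' := congrArg (Polynomial.aeval A) hs
  have hA2 : A ^ 2 = A + 1 := fibEnd_sq C
  have hinv : A * (A - 1) = 1 := by
    rw [mul_sub, ← pow_two, hA2, mul_one, add_sub_cancel_left]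
  have hcomm : Commute A (A - 1) := (Commute.refl A).sub_right (Commute.one_right A)
  have hunit : A ^ 3 ^ m * (A - 1) ^ 3 ^ m = 1 := by rw [← hcomm.mul_pow, hinv, one_pow]
  have hb : Polynomial.aeval A ((Polynomial.X - 1) ^ 3 ^ m : Polynomial ℤ) = (A - 1) ^ 3 ^ m := by
    simp
  refine ⟨(Polynomial.X - 1) ^ 3 ^ m, (Polynomial.X - 1) ^ 3 ^ m * s, fun v hv => ?_, fun v => ?_⟩
  · rw [hb] at hv
    have := congrArg (fun φ : Module.End ℤ (C × C) => φ v) hunit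
    simp only [Module.End.mul_apply, hv, map_zero, Module.End.one_apply] at this
    exact this.symm
  · simp only [sub_add_cancel, one_pow, map_add, map_pow, map_sub, map_one, map_mul,
      Polynomial.aeval_X, map_natCast] at hs'
    rw [← pow_mul, hA2, add_sub_cancel_right] at hs'
    rw [map_mul, hb, hs', Module.End.mul_apply]
    have h3 : (3 : C) • v = (3 : ℕ) • v := by
      rw [← Nat.cast_smul_eq_nsmul C]
      norm_num
    have hunit' : (A - 1) ^ 3 ^ m * A ^ 3 ^ m = 1 := by
      rw [← (hcomm.pow_pow _ _).eq, hunit]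
    have h1 := congrArg (fun φ : Module.End ℤ (C × C) => φ v) hunit'
    simp only [Module.End.mul_apply, Module.End.one_apply] at h1
    rw [h3, LinearMap.add_apply, LinearMap.add_apply, Module.End.one_apply, add_right_comm,
      add_sub_cancel_right, map_add, h1, Module.End.mul_apply, Module.End.natCast_apply, map_nsmul,
      map_nsmul, map_nsmul]

lemma norm_gMap_le {u : C × C} (hu : ‖u‖ ≤ 1) : ‖gMap u‖ ≤ 1 := by
  have h1 := (norm_fst_le u).trans hu
  have h2 := (norm_snd_le u).trans hu
  rw [gMap, Prod.norm_mk]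
  refine max_le h2 ((norm_sub_le_max_norm _ _).trans (max_le
    ((IsUltrametricDist.norm_add_le_max _ _).trans (max_le h1 h2)) ?_))
  rw [norm_pow]
  exact pow_le_one₀ (norm_nonneg _) h2

lemma norm_gMap_iterate_le {u : C × C} (hu : ‖u‖ ≤ 1) (k : ℕ) : ‖gMap^[k] u‖ ≤ 1 := by
  induction k with
  | zero => exact hu
  | succ k ih =>
    rw [Function.iterate_succ_apply']
    exact norm_gMap_le ih

/-- The derivative of y³ is divisible by 3, so modulo 3 the linearisation of g is the same matrix at
every point of the unit ball. -/
lemma norm_gMap_add_sub_le {θ : ℝ} (h3 : ‖(3 : C)‖ ≤ θ) (hθ : θ ≤ 1) {u δ : C × C} (hu : ‖u‖ ≤ 1)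
    (hδ : ‖δ‖ ≤ θ) : ‖gMap (u + δ) - gMap u - fibEnd C δ‖ ≤ θ * ‖δ‖ := by
  have h2 := (norm_snd_le u).trans hu
  have hd := norm_snd_le δ
  have hθ0 : 0 ≤ θ := (norm_nonneg _).trans h3
  have heq : gMap (u + δ) - gMap u - fibEnd C δ =
      (0, -((3 * (u.2 * (u.2 + δ.2)) + δ.2 ^ 2) * δ.2)) := by
    refine Prod.ext ?_ ?_ <;>
      simp only [gMap, fibEnd_apply, Prod.fst_add, Prod.snd_add, Prod.fst_sub, Prod.snd_sub] <;> ring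
  rw [heq, Prod.norm_mk, norm_zero, norm_neg, norm_mul]
  refine max_le (by positivity) (mul_le_mul ?_ hd (norm_nonneg _) hθ0)
  refine (IsUltrametricDist.norm_add_le_max _ _).trans (max_le ?_ ?_)
  · rw [norm_mul, norm_mul]
    have h4 : ‖u.2 + δ.2‖ ≤ 1 := (IsUltrametricDist.norm_add_le_max _ _).trans
      (max_le h2 (hd.trans (hδ.trans hθ)))
    exact (mul_le_of_le_one_right (norm_nonneg _)
      (mul_le_one₀ h2 (norm_nonneg _) h4)).trans h3
  · rw [norm_pow, pow_two]
    exact (mul_le_of_le_one_left (norm_nonneg _) (hd.trans (hδ.trans hθ))).trans (hd.trans hδ)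

/-- The ultrametric inequality keeps the errors from accumulating, so θ does not depend on k. -/
lemma norm_gMap_iterate_add_sub_le {θ : ℝ} (h3 : ‖(3 : C)‖ ≤ θ) (hθ : θ ≤ 1) {u δ : C × C}
    (hu : ‖u‖ ≤ 1) (hδ : ‖δ‖ ≤ θ) (k : ℕ) :
    ‖gMap^[k] (u + δ) - gMap^[k] u - (fibEnd C ^ k) δ‖ ≤ θ * ‖δ‖ := by
  have hθ0 : 0 ≤ θ := (norm_nonneg _).trans h3
  induction k with
  | zero => simpa using by positivity
  | succ k ih =>
    rw [Function.iterate_succ_apply', Function.iterate_succ_apply', pow_succ', Module.End.mul_apply]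
    set e := gMap^[k] (u + δ) - gMap^[k] u - (fibEnd C ^ k) δ with he
    set w := (fibEnd C ^ k) δ + e with hw
    have hA : ‖(fibEnd C ^ k) δ‖ ≤ ‖δ‖ := by
      simpa using norm_aeval_fibEnd_le (C := C) (Polynomial.X ^ k) δ
    have hwn : ‖w‖ ≤ ‖δ‖ := (IsUltrametricDist.norm_add_le_max _ _).trans
      (max_le hA (ih.trans (mul_le_of_le_one_left (norm_nonneg _) hθ)))
    have hgw : gMap^[k] (u + δ) = gMap^[k] u + w := by rw [hw, he]; abel
    have hstep := norm_gMap_add_sub_le h3 hθ (norm_gMap_iterate_le hu k) (hwn.trans hδ)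
    have heq : gMap (gMap^[k] (u + δ)) - gMap (gMap^[k] u) - fibEnd C ((fibEnd C ^ k) δ) =
        (gMap (gMap^[k] u + w) - gMap (gMap^[k] u) - fibEnd C w) + fibEnd C e := by
      rw [hgw, hw, map_add]
      abel
    rw [heq]
    refine (IsUltrametricDist.norm_add_le_max _ _).trans (max_le ?_ ?_)
    · exact hstep.trans (by gcongr)
    · have := norm_aeval_fibEnd_le (C := C) Polynomial.X e
      rw [Polynomial.aeval_X] at this
      exact this.trans ih

/-- A point that is periodic of period `2 * 3 ^ m` modulo the maximal ideal is congruent to a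
periodic point. -/
lemma exists_periodic_near [CompleteSpace C] (h3 : ‖(3 : C)‖ < 1) (m : ℕ) {u₀ : C × C}
    (hu₀ : ‖u₀‖ ≤ 1) (hper : ‖gMap^[2 * 3 ^ m] u₀ - u₀‖ < 1) :
    ∃ u : C × C, ‖u - u₀‖ < 1 ∧ gMap^[2 * 3 ^ m] u = u := by
  obtain ⟨b, r, hb, hbr⟩ := exists_fibEnd_inverse (C := C) m
  set n := 2 * 3 ^ m
  set ρ := ‖gMap^[n] u₀ - u₀‖ with hρ
  set θ := max ‖(3 : C)‖ ρ with hθdef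
  have hθ1 : θ < 1 := max_lt h3 hper
  have hθ0 : 0 ≤ θ := (norm_nonneg _).trans (le_max_left _ _)
  -- A Newton iteration with a fixed approximate inverse b of the derivative of gⁿ - 1. It contracts
  -- the ball of radius ρ by θ, and its fixed points are periodic because b is injective.
  let Φ : C × C → C × C := fun u => u - Polynomial.aeval (fibEnd C) b (gMap^[n] u - u)
  have hcontr (u δ : C × C) (hu : ‖u‖ ≤ 1) (hδ : ‖δ‖ ≤ ρ) : ‖Φ (u + δ) - Φ u‖ ≤ θ * ‖δ‖ := by
    have he := norm_gMap_iterate_add_sub_le (le_max_left _ _) hθ1.le hu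
      (hδ.trans (le_max_right ‖(3 : C)‖ ρ)) n
    set e := gMap^[n] (u + δ) - gMap^[n] u - (fibEnd C ^ n) δ with hedef
    have h1 : gMap^[n] (u + δ) - (u + δ) =
        (gMap^[n] u - u) + ((fibEnd C ^ n) δ - δ) + e := by rw [hedef]; abel
    have h2 : Φ (u + δ) - Φ u = -(Polynomial.aeval (fibEnd C) r ((3 : C) • δ) +
        Polynomial.aeval (fibEnd C) b e) := by
      simp only [Φ]
      rw [h1, map_add, map_add, hbr]
      abel
    rw [h2, norm_neg]
    refine (IsUltrametricDist.norm_add_le_max _ _).trans (max_le ?_ ?_)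
    · refine (norm_aeval_fibEnd_le _ _).trans ?_
      rw [norm_smul]
      gcongr
      exact le_max_left _ _
    · exact (norm_aeval_fibEnd_le _ _).trans he
  have hball {u : C × C} (hu : u ∈ Metric.closedBall u₀ ρ) : ‖u - u₀‖ ≤ ρ := by
    rwa [mem_closedBall_iff_norm] at hu
  have hball1 {u : C × C} (hu : u ∈ Metric.closedBall u₀ ρ) : ‖u‖ ≤ 1 := by
    rw [← sub_add_cancel u u₀]
    exact (IsUltrametricDist.norm_add_le_max _ _).trans (max_le ((hball hu).trans hper.le) hu₀)
  have hmaps : Set.MapsTo Φ (Metric.closedBall u₀ ρ) (Metric.closedBall u₀ ρ) := by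
    intro u hu
    rw [mem_closedBall_iff_norm]
    have h1 := hcontr u₀ (u - u₀) hu₀ (hball hu)
    rw [add_sub_cancel] at h1
    have h2 : ‖Φ u₀ - u₀‖ ≤ ρ := by
      simp only [Φ, sub_sub_cancel_left, norm_neg]
      exact norm_aeval_fibEnd_le _ _
    rw [← sub_add_sub_cancel (Φ u) (Φ u₀) u₀]
    refine (IsUltrametricDist.norm_add_le_max _ _).trans (max_le (h1.trans ?_) h2)
    exact (mul_le_of_le_one_left (norm_nonneg _) hθ1.le).trans (hball hu)
  have hcw : ContractingWith ⟨θ, hθ0⟩ (hmaps.restrict Φ _ _) := by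
    refine ⟨hθ1, LipschitzWith.of_dist_le_mul fun v w => ?_⟩
    rw [Subtype.dist_eq, Subtype.dist_eq, Set.MapsTo.val_restrict_apply,
      Set.MapsTo.val_restrict_apply, dist_eq_norm, dist_eq_norm]
    have h := hcontr w.1 (v.1 - w.1) (hball1 w.2) ?_
    · rwa [add_sub_cancel] at h
    · rw [← sub_sub_sub_cancel_right v.1 w.1 u₀]
      exact (norm_sub_le_max_norm _ _).trans (max_le (hball v.2) (hball w.2))
  obtain ⟨u, hu, hfix, -⟩ := hcw.exists_fixedPoint' Metric.isClosed_closedBall.isComplete hmaps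
    (Metric.mem_closedBall_self (norm_nonneg _)) (edist_ne_top u₀ _)
  refine ⟨u, (hball hu).trans_lt hper, ?_⟩
  have h0 := hb (gMap^[n] u - u) (sub_eq_self.1 hfix)
  exact sub_eq_zero.1 h0

end Lifting

end AffineDyn

namespace AffineDyn

/-! ### A lower bound for heights -/

section HeightBound

open Height NumberField

variable {K : Type*} [Field K] [NumberField K]

/-- The norm `N` of the denominator ideal of `z` is at most the height of `z`, and it clears the
denominators of every product of distinct conjugates of `z`. -/
lemma exists_denominator_le_mulHeight (z : K) :
    ∃ N : ℕ, N ≠ 0 ∧ (N : ℝ) ≤ mulHeight ![z, 1] ∧ ∀ I : Finset (K →ₐ[ℚ] Qbar),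
      IsIntegral ℤ ((N : Qbar) * ∏ σ ∈ I, σ z) := by
  obtain ⟨n, hn, a, ha₁, ha₂⟩ := exists_nat_ne_zero_exists_integer_mul_eq_and_absNorm_span_eq_pow z
  refine ⟨n, hn, ?_, fun I => ?_⟩
  · rw [← totalWeight_eq_finrank] at ha₂
    have hv (i : Fin 2) : (![a, n] i : K) = ![(a : K), n] i := by fin_cases i <;> rfl
    rw [← mulHeight₁_eq_mulHeight, ← mul_div_cancel_left₀ z (mod_cast hn : (n : K) ≠ 0), ha₁,
      mulHeight₁_div_eq_mulHeight, NumberField.mulHeight_eq (by simp [hn])]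
    refine le_of_mul_le_mul_left ?_ (show (0 : ℝ) < n ^ (totalWeight K - 1) by positivity)
    have : n ^ (totalWeight K - 1) * ∏ᶠ (v : FinitePlace K), ⨆ i, v (![(a : K), n] i) = 1 := by
      have h := absNorm_mul_finprod_finitePlace_eq_one (show ![a, (n : 𝓞 K)] ≠ 0 by simp [hn])
      have hr : Set.range ![a, (n : 𝓞 K)] = {(n : 𝓞 K), a} := by simp
      rw [hr, ha₂] at h
      simpa [hv] using h
    rw [pow_sub_one_mul (totalWeight_pos K).ne', mul_left_comm, this, mul_one,
      totalWeight_eq_sum_mult, ← Finset.prod_pow_eq_pow_sum Finset.univ]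
    gcongr
    exact Finite.le_ciSup_of_le 1 <| by simp
  · set J : Ideal (𝓞 K) := Ideal.span {(n : 𝓞 K), a} with hJ
    -- Here z = a/n and d is the denominator ideal (n)/J. Since J has norm n^([K:ℚ]-1), d has norm
    -- n.
    obtain ⟨d, hd⟩ : J ∣ Ideal.span {(n : 𝓞 K)} :=
      Ideal.dvd_iff_le.2 (Ideal.span_mono (by simp))
    have hnd : Ideal.absNorm d = n := by
      have h := congrArg Ideal.absNorm hd
      rw [map_mul, Ideal.absNorm_span_natCast, RingOfIntegers.rank, ha₂,
        ← pow_sub_one_mul (Module.finrank_pos (R := ℚ) (M := K)).ne'] at h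
      exact (mul_left_cancel₀ (pow_ne_zero _ hn) h).symm
    have hmem : (n : ℤ) ∈ Ideal.span (Algebra.intNorm ℤ (𝓞 K) '' (d : Set (𝓞 K))) := by
      have h := Ideal.relNorm_int (𝓞 K) d
      rw [hnd] at h
      have h2 : (n : ℤ) ∈ Ideal.relNorm ℤ d := h ▸ Ideal.mem_span_singleton_self _
      exact h2
    -- It suffices to treat c the norm of some x in d. Its conjugate factors are distributed:
    -- σ(x)σ(z) = σ(xz) is integral for σ in I, and σ(x) for the others.
    have key : ∀ c ∈ Ideal.span (Algebra.intNorm ℤ (𝓞 K) '' (d : Set (𝓞 K))),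
        IsIntegral ℤ ((c : Qbar) * ∏ σ ∈ I, σ z) := by
      intro c hc
      induction hc using Submodule.span_induction with
      | mem c hc =>
        obtain ⟨x, hx, rfl⟩ := hc
        obtain ⟨y, hy⟩ : ∃ y : 𝓞 K, (x : K) * z = y := by
          have hxa : x * a ∈ Ideal.span {(n : 𝓞 K)} := by
            rw [hd, mul_comm x a]
            exact Ideal.mul_mem_mul (Ideal.subset_span (by simp)) hx
          obtain ⟨y, hy⟩ := Ideal.mem_span_singleton'.1 hxa
          refine ⟨y, mul_left_cancel₀ (mod_cast hn : (n : K) ≠ 0) ?_⟩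
          have hy' := congrArg (algebraMap (𝓞 K) K) hy
          simp only [map_mul, map_natCast] at hy'
          rw [mul_left_comm, ha₁, mul_comm (n : K)]
          exact hy'.symm
        have hnorm : ((Algebra.intNorm ℤ (𝓞 K) x : ℤ) : Qbar) = ∏ σ : K →ₐ[ℚ] Qbar, σ x := by
          rw [← Algebra.norm_eq_prod_embeddings ℚ Qbar (x : K), ← Algebra.coe_norm_int,
            Algebra.intNorm_eq_norm]
          simp
        classical
        rw [hnorm, ← Finset.prod_mul_prod_compl I, mul_right_comm, ← Finset.prod_mul_distrib]
        refine IsIntegral.mul (IsIntegral.prod _ fun σ _ => ?_) (IsIntegral.prod _ fun σ _ => ?_)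
        · rw [← map_mul, hy]
          exact y.isIntegral_coe.map (σ.restrictScalars ℤ)
        · exact x.isIntegral_coe.map (σ.restrictScalars ℤ)
      | zero => simpa using isIntegral_zero
      | add c e _ _ hc he =>
        rw [Int.cast_add, add_mul]
        exact hc.add he
      | smul b c _ hc =>
        rw [smul_eq_mul, Int.cast_mul, mul_assoc]
        exact (isIntegral_algebraMap (R := ℤ) (x := b)).mul hc
    simpa using key n hmem

end HeightBound

/-! ### The `3`-adic absolute value on the algebraic numbers -/

section ThreeAdic

instance : Fact (Nat.Prime 3) := ⟨Nat.prime_three⟩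

/-- An embedding of the algebraic numbers into the field of `3`-adic complex numbers. -/
noncomputable def toC3 : Qbar →ₐ[ℚ] ℂ_[3] := IsAlgClosed.lift

lemma norm_natCast_C3 (n : ℕ) : ‖(n : ℂ_[3])‖ = ‖(n : ℚ_[3])‖ := by
  rw [← PadicComplex.norm_extends' 3 (n : ℚ_[3])]
  simp

lemma norm_le_one_of_isIntegral {x : ℂ_[3]} (hx : IsIntegral ℤ x) : ‖x‖ ≤ 1 := by
  by_contra! hlt
  obtain ⟨p, hp, hpx⟩ := hx
  have h0 : x ^ p.natDegree = -∑ i ∈ Finset.range p.natDegree, (p.coeff i : ℂ_[3]) * x ^ i := by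
    have h := hpx
    rw [Polynomial.eval₂_eq_sum_range, Finset.sum_range_succ, hp.coeff_natDegree] at h
    simp only [eq_intCast, Int.cast_one, one_mul] at h
    linear_combination h
  have h1 : ‖x‖ ^ p.natDegree < ‖x‖ ^ p.natDegree := by
    rw [← norm_pow]
    nth_rewrite 1 [h0]
    rw [norm_neg, norm_pow]
    rcases (Finset.range p.natDegree).eq_empty_or_nonempty with he | he
    · rw [he, Finset.sum_empty, norm_zero]
      positivity
    · obtain ⟨i, hi, hle⟩ := IsUltrametricDist.exists_norm_finsetSum_le_of_nonempty he
        (fun i => (p.coeff i : ℂ_[3]) * x ^ i)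
      refine hle.trans_lt ?_
      rw [norm_mul, norm_pow]
      refine (mul_le_of_le_one_left (by positivity)
        (IsUltrametricDist.norm_intCast_le_one _ _)).trans_lt ?_
      exact pow_lt_pow_right₀ hlt (Finset.mem_range.1 hi)
  exact lt_irrefl _ h1

lemma pow_le_of_norm_natCast_le {N e : ℕ} (hN : N ≠ 0) (h : (3 : ℝ) ^ e * ‖(N : ℂ_[3])‖ ≤ 1) :
    3 ^ e ≤ N := by
  have h1 : ‖((N : ℤ) : ℚ_[3])‖ ≤ (3 : ℕ) ^ (-(e : ℤ)) := by
    rw [zpow_neg, zpow_natCast, Int.cast_natCast, ← norm_natCast_C3]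
    rwa [← one_div, le_div_iff₀ (by positivity), mul_comm]
  rw [Padic.norm_int_le_pow_iff_dvd] at h1
  exact Nat.le_of_dvd (Nat.pos_of_ne_zero hN) (by exact_mod_cast h1)

open Height in
/-- If sufficiently many conjugates of the coordinate `P i` have large `3`-adic absolute value, then
`P` has large height. -/
lemma le_height_of_conjugates {N : ℕ} (P : Fin N → Qbar) (i : Fin N) (m : ℕ)
    (I : Finset (fieldOfDef P →ₐ[ℚ] Qbar)) (hI : ∀ σ ∈ I, 3 ^ m ≤ ‖toC3 (σ (coords P i))‖) :
    (I.card : ℝ) / Module.finrank ℚ (fieldOfDef P) * (m * Real.log 3) ≤ height P := by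
  obtain ⟨D, hD, hDle, hint⟩ := exists_denominator_le_mulHeight (coords P i)
  -- The integral number D·∏ σ(z) has norm at most 1 while the product has norm at least 3^(m|I|).
  -- So 3^(m|I|) divides D, which is bounded by the height.
  have h1 := norm_le_one_of_isIntegral ((hint I).map (toC3.restrictScalars ℤ))
  have h2 : (3 : ℝ) ^ (m * I.card) * ‖(D : ℂ_[3])‖ ≤ 1 := by
    refine le_trans ?_ h1
    simp only [AlgHom.coe_restrictScalars', map_mul, map_natCast, map_prod, norm_mul, norm_prod]
    rw [mul_comm, pow_mul]
    gcongr
    rw [← Finset.prod_const]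
    exact Finset.prod_le_prod (fun _ _ => by positivity) hI
  have h3 : ((3 : ℝ) ^ (m * I.card)) ≤ D := by exact_mod_cast pow_le_of_norm_natCast_le hD h2
  have h4 : mulHeight ![coords P i, 1] ≤
      mulHeight (Matrix.vecCons (1 : fieldOfDef P) (coords P)) := by
    have := mulHeight_comp_le (![i.succ, 0] : Fin 2 → Fin (N + 1))
      (Matrix.vecCons (1 : fieldOfDef P) (coords P))
    convert this using 2
    ext j
    fin_cases j <;> simp
  have h5 : (m * I.card : ℝ) * Real.log 3 ≤
      logHeight (Matrix.vecCons (1 : fieldOfDef P) (coords P)) := by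
    rw [logHeight_eq_log_mulHeight]
    have := Real.log_le_log (by positivity) (h3.trans (hDle.trans h4))
    rw [Real.log_pow] at this
    exact_mod_cast this
  rw [height, div_mul_eq_mul_div]
  gcongr
  linarith

end ThreeAdic

end AffineDyn

namespace AffineDyn

/-! ### The residue field of the `3`-adic complex numbers -/

section Residue

/-- The valuation ring of the field of `3`-adic complex numbers. -/
noncomputable abbrev O3 : ValuationSubring ℂ_[3] :=
  (NormedField.valuation (K := ℂ_[3])).valuationSubring

/-- The residue field of the field of `3`-adic complex numbers. -/
abbrev K3 : Type := IsLocalRing.ResidueField O3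

lemma mem_O3 {x : ℂ_[3]} : x ∈ O3 ↔ ‖x‖ ≤ 1 := Iff.rfl

lemma residue_eq_zero_iff {x : O3} : IsLocalRing.residue O3 x = 0 ↔ ‖(x : ℂ_[3])‖ < 1 := by
  rw [IsLocalRing.residue_eq_zero_iff, IsLocalRing.mem_maximalIdeal, mem_nonunits_iff,
    lt_iff_le_and_ne, and_iff_right (mem_O3.1 x.2), not_iff_not]
  constructor
  · rintro ⟨u, rfl⟩
    have h1 : ‖((u : O3) : ℂ_[3])‖ * ‖((u⁻¹ : O3ˣ) : ℂ_[3])‖ = 1 := by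
      rw [← norm_mul]
      have : ((u : O3) : ℂ_[3]) * ((u⁻¹ : O3ˣ) : O3) = 1 := congrArg O3.subtype (Units.mul_inv u)
      rw [this, norm_one]
    have h2 : ‖((u : O3) : ℂ_[3])‖ ≤ 1 := mem_O3.1 (u : O3).2
    have h3 : ‖((u⁻¹ : O3ˣ) : ℂ_[3])‖ ≤ 1 := mem_O3.1 (u⁻¹ : O3ˣ).1.2
    nlinarith [norm_nonneg ((u : O3) : ℂ_[3])]
  · intro h
    have h0 : (x : ℂ_[3]) ≠ 0 := by
      rintro h0
      rw [h0, norm_zero] at h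
      exact zero_ne_one h
    refine IsUnit.of_mul_eq_one (⟨(x : ℂ_[3])⁻¹, ?_⟩ : O3) (Subtype.ext (mul_inv_cancel₀ h0))
    rw [mem_O3, norm_inv, h, inv_one]

lemma norm_three_C3 : ‖(3 : ℂ_[3])‖ = 1 / 3 := by
  have h := norm_natCast_C3 3
  rw [Padic.norm_p] at h
  rw [one_div]
  exact_mod_cast h

instance charP_K3 : CharP K3 3 := by
  rw [CharP.charP_iff_prime_eq_zero Nat.prime_three]
  have h : IsLocalRing.residue O3 (3 : ℕ) = 0 := by
    rw [residue_eq_zero_iff]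
    have := norm_three_C3
    push_cast
    rw [show ((3 : O3) : ℂ_[3]) = 3 from rfl, this]
    norm_num
  rwa [map_natCast] at h

/-- A monic lift of the polynomial has a root in ℂ₃, which is integral over the valuation ring,
hence lies in it and can be reduced. -/
instance isAlgClosed_K3 : IsAlgClosed K3 := by
  refine IsAlgClosed.of_exists_root _ fun p hp hirr => ?_
  obtain ⟨q, hq, hdeg, hmon⟩ := Polynomial.lifts_and_natDegree_eq_and_monic
    ((Polynomial.mem_lifts p).2 (Polynomial.map_surjective _ IsLocalRing.residue_surjective p)) hp
  have hqdeg : (q.map (algebraMap O3 ℂ_[3])).degree ≠ 0 := by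
    rw [hmon.degree_map]
    intro h0
    have : p.natDegree = 0 := by rw [← hdeg, Polynomial.natDegree_eq_zero_iff_degree_le_zero, h0]
    exact hirr.natDegree_pos.ne' this
  obtain ⟨x, hx⟩ := IsAlgClosed.exists_root _ hqdeg
  have hint : IsIntegral O3 x := ⟨q, hmon, by rwa [Polynomial.IsRoot, Polynomial.eval_map] at hx⟩
  obtain ⟨y, rfl⟩ := IsIntegrallyClosed.isIntegral_iff.1 hint
  refine ⟨IsLocalRing.residue O3 y, ?_⟩
  have h0 : q.eval y = 0 := by
    rw [Polynomial.IsRoot, Polynomial.eval_map_algebraMap, Polynomial.aeval_algebraMap_apply] at hx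
    exact (map_eq_zero_iff _ (FaithfulSMul.algebraMap_injective O3 ℂ_[3])).1 (by simpa using hx)
  rw [← hq, Polynomial.eval_map_apply, h0, map_zero]

/-- The minimal polynomial over ℚ already splits in `Qbar`. This descends the periodic points found
by completeness of ℂ₃. -/
lemma exists_toC3_eq {x : ℂ_[3]} (hx : IsIntegral ℤ x) : ∃ p : Qbar, toC3 p = x := by
  have hxQ : IsIntegral ℚ x := hx.tower_top
  have h := Polynomial.Splits.image_rootSet (f := minpoly ℚ x) (IsAlgClosed.splits _) toC3
  have hmem : x ∈ (minpoly ℚ x).rootSet ℂ_[3] :=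
    (Polynomial.mem_rootSet_of_ne (minpoly.ne_zero hxQ)).2 (minpoly.aeval ℚ x)
  rw [← h] at hmem
  obtain ⟨p, -, hp⟩ := hmem
  exact ⟨p, hp⟩

/-- Every point of the residue plane with coordinates in the field with `3 ^ 3 ^ m` elements lifts
to a periodic point of `f`, whose last coordinate is, up to the factor `2 ^ n - 1`, congruent to a
difference of traces. -/
lemma exists_periodic_lift (m : ℕ) {a b : K3} (ha : a ^ 3 ^ 3 ^ m = a) (hb : b ^ 3 ^ 3 ^ m = b) :
    ∃ P ∈ Per (2 * 3 ^ m) (onPoints f), ∃ x y w : O3,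
      (x : ℂ_[3]) = toC3 (P 0) ∧ (y : ℂ_[3]) = toC3 (P 1) ∧
      (w : ℂ_[3]) = (2 ^ (2 * 3 ^ m) - 1) * toC3 (P 2) ∧
      IsLocalRing.residue O3 x = a ∧ IsLocalRing.residue O3 y = b ∧
      IsLocalRing.residue O3 w = trThree m a - trThree m b := by
  set n := 2 * 3 ^ m with hn
  have hn0 : 0 < n := by positivity
  obtain ⟨x₀, hx₀⟩ := IsLocalRing.residue_surjective (R := O3) a
  obtain ⟨y₀, hy₀⟩ := IsLocalRing.residue_surjective (R := O3) b
  have hnorm (z : O3) : ‖(z : ℂ_[3])‖ ≤ 1 := mem_O3.1 z.2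
  have hres := map_gMap_iterate (IsLocalRing.residue O3) (x₀, y₀) n
  simp only [Prod.map_apply, hx₀, hy₀] at hres
  rw [gMap_iterate_eq_self (u := (a, b)) ha hb] at hres
  have hcoe := map_gMap_iterate O3.subtype (x₀, y₀) n
  set v := gMap^[n] (x₀, y₀)
  have hnear : ‖gMap^[n] ((x₀ : ℂ_[3]), (y₀ : ℂ_[3])) - ((x₀ : ℂ_[3]), (y₀ : ℂ_[3]))‖ < 1 := by
    have h1 : gMap^[n] ((x₀ : ℂ_[3]), (y₀ : ℂ_[3])) - ((x₀ : ℂ_[3]), (y₀ : ℂ_[3])) =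
        (((v.1 - x₀ : O3) : ℂ_[3]), ((v.2 - y₀ : O3) : ℂ_[3])) :=
      congrArg (· - ((x₀ : ℂ_[3]), (y₀ : ℂ_[3]))) hcoe.symm
    rw [h1, Prod.norm_mk]
    refine max_lt ?_ ?_ <;> rw [← residue_eq_zero_iff, map_sub, sub_eq_zero]
    · exact (congrArg Prod.fst hres).trans hx₀.symm
    · exact (congrArg Prod.snd hres).trans hy₀.symm
  obtain ⟨u, hu, hper⟩ := exists_periodic_near (by rw [norm_three_C3]; norm_num) m
    (max_le (hnorm x₀) (hnorm y₀)) hnear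
  have hint : IsIntegral ℤ u.1 ∧ IsIntegral ℤ u.2 := isIntegral_of_isPeriodic ℤ hn0 hper
  obtain ⟨p, hp⟩ := exists_toC3_eq hint.1
  obtain ⟨q, hq⟩ := exists_toC3_eq hint.2
  have huv : Prod.map toC3 toC3 (p, q) = u := by rw [Prod.map_apply, hp, hq]
  let x : O3 := ⟨u.1, norm_le_one_of_isIntegral hint.1⟩
  let y : O3 := ⟨u.2, norm_le_one_of_isIntegral hint.2⟩
  have hx : IsLocalRing.residue O3 x = a := by
    rw [← hx₀, ← sub_eq_zero, ← map_sub, residue_eq_zero_iff]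
    exact (norm_fst_le (u - ((x₀ : ℂ_[3]), (y₀ : ℂ_[3])))).trans_lt hu
  have hy : IsLocalRing.residue O3 y = b := by
    rw [← hy₀, ← sub_eq_zero, ← map_sub, residue_eq_zero_iff]
    exact (norm_snd_le (u - ((x₀ : ℂ_[3]), (y₀ : ℂ_[3])))).trans_lt hu
  have hpq : gMap^[n] (p, q) = (p, q) := by
    refine (Prod.map_injective.2 ⟨toC3.injective, toC3.injective⟩) ?_
    refine Eq.trans ?_ huv.symm
    exact (map_gMap_iterate toC3.toRingHom (p, q) n).trans ((congrArg _ huv).trans hper)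
  let s : Qbar := ∑ k ∈ Finset.range n, 2 ^ (n - 1 - k) * (gMap^[k] (p, q)).2
  have hs := two_pow_sub_one_ne_zero hn0.ne'
  refine ⟨![p, q, s / (2 ^ n - 1)], (mem_Per_iff _).2 ⟨hpq, ?_⟩, x, y,
    ∑ k ∈ Finset.range n, 2 ^ (n - 1 - k) * (gMap^[k] (x, y)).2, hp.symm, hq.symm, ?_, hx, hy, ?_⟩
  · exact mul_div_cancel₀ s hs
  · have h1 : (2 ^ n - 1) * toC3 (s / (2 ^ n - 1)) = toC3 s := by
      have h2 : ((2 : ℂ_[3]) ^ n - 1) = toC3 (2 ^ n - 1) := by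
        rw [map_sub, map_pow, map_one, map_ofNat]
      rw [h2, ← map_mul, mul_div_cancel₀ s hs]
    refine Eq.trans ?_ h1.symm
    have h3 (k : ℕ) : ((gMap^[k] (x, y)).2 : ℂ_[3]) = toC3 (gMap^[k] (p, q)).2 := by
      have h4 := map_gMap_iterate O3.subtype (x, y) k
      have h5 := map_gMap_iterate toC3.toRingHom (p, q) k
      have h6 : Prod.map O3.subtype O3.subtype (x, y) = Prod.map toC3 toC3 (p, q) := huv.symm
      exact congrArg Prod.snd (h4.trans ((congrArg _ h6).trans h5.symm))
    have h7 : O3.subtype (∑ k ∈ Finset.range n, 2 ^ (n - 1 - k) * (gMap^[k] (x, y)).2) = toC3 s := by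
      simp only [s, map_sum, map_mul, map_pow, map_ofNat]
      exact Finset.sum_congr rfl fun k _ => congrArg _ (h3 k)
    exact h7
  · have h8 (k : ℕ) : IsLocalRing.residue O3 (gMap^[k] (x, y)).2 = (gMap^[k] (a, b)).2 := by
      have h9 := map_gMap_iterate (IsLocalRing.residue O3) (x, y) k
      rw [Prod.map_apply _ _ x y, hx, hy] at h9
      exact congrArg Prod.snd h9
    rw [← sum_two_pow_mul_gMap_iterate (u := (a, b)) ha hb, ← hn]
    simp only [map_sum, map_mul, map_pow, map_ofNat, h8]

end Residue

end AffineDyn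

namespace AffineDyn

/-! ### Avoiding a hypersurface by a congruence condition -/

section Avoid

/-- A hypersurface avoids all points whose last coordinate has a sufficiently small denominator and
whose other coordinates have residues outside of some plane curve. -/
lemma exists_residue_curve {F : MvPolynomial (Fin 3) Qbar} (hF : F ≠ 0) :
    ∃ G : MvPolynomial (Fin 2) K3, G ≠ 0 ∧ ∃ ε : ℝ, 0 < ε ∧
      ∀ (P : Fin 3 → Qbar) (x y w : O3) (M : ℂ_[3]), (x : ℂ_[3]) = toC3 (P 0) →
        (y : ℂ_[3]) = toC3 (P 1) → (w : ℂ_[3]) = M * toC3 (P 2) → ‖M‖ < ε →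
        MvPolynomial.eval ![IsLocalRing.residue O3 x, IsLocalRing.residue O3 y] G ≠ 0 →
        IsLocalRing.residue O3 w ≠ 0 → MvPolynomial.eval P F ≠ 0 := by
  classical
  have hsupp : F.support.Nonempty := MvPolynomial.support_nonempty.2 hF
  -- After multiplication by M^e, with e the degree of F in z, the terms of lower z-degree keep a
  -- positive power of the small number M. Only the coefficient of z^e matters; normalised by its
  -- largest coefficient, it reduces to a nonzero G.
  obtain ⟨s₁, hs₁, he⟩ := F.support.exists_max_image (fun s => s 2) hsupp
  set e := s₁ 2 with hedef
  let T := F.support.filter fun s => s 2 = e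
  have hT : T.Nonempty := ⟨s₁, Finset.mem_filter.2 ⟨hs₁, rfl⟩⟩
  let c : (Fin 3 →₀ ℕ) → ℂ_[3] := fun s => toC3 (F.coeff s)
  obtain ⟨s₀, hs₀, hmax⟩ := T.exists_max_image (fun s => ‖c s‖) hT
  have hc₀ : c s₀ ≠ 0 := (map_ne_zero toC3).2
    (MvPolynomial.mem_support_iff.1 (Finset.mem_filter.1 hs₀).1)
  let d : (Fin 3 →₀ ℕ) → ℂ_[3] := fun s => c s / c s₀
  have hd {s} (hs : s ∈ T) : ‖d s‖ ≤ 1 := by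
    rw [norm_div, div_le_one (norm_pos_iff.2 hc₀)]
    exact hmax s hs
  let r : (Fin 3 →₀ ℕ) → O3 := fun s => if h : ‖d s‖ ≤ 1 then ⟨d s, h⟩ else 0
  have hr {s} (hs : s ∈ T) : (r s : ℂ_[3]) = d s := by simp [r, hd hs]
  let π : (Fin 3 →₀ ℕ) → (Fin 2 →₀ ℕ) := fun s => Finsupp.equivFunOnFinite.symm ![s 0, s 1]
  let G : MvPolynomial (Fin 2) K3 :=
    ∑ s ∈ T, MvPolynomial.monomial (π s) (IsLocalRing.residue O3 (r s))
  have hπ {s} (hs : s ∈ T) (h : π s = π s₀) : s = s₀ := by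
    have h' := Finsupp.equivFunOnFinite.symm.injective h
    ext i
    fin_cases i
    · exact congrFun h' 0
    · exact congrFun h' 1
    · exact (Finset.mem_filter.1 hs).2.trans (Finset.mem_filter.1 hs₀).2.symm
  have hG : G.coeff (π s₀) = 1 := by
    rw [MvPolynomial.coeff_sum, Finset.sum_eq_single s₀]
    · rw [MvPolynomial.coeff_monomial, if_pos rfl]
      have : r s₀ = 1 := Subtype.ext (by rw [hr hs₀]; exact div_self hc₀)
      rw [this, map_one]
    · intro s hs hne
      rw [MvPolynomial.coeff_monomial, if_neg fun h => hne (hπ hs h)]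
    · exact fun h => absurd hs₀ h
  have hΓ (s) (hs : s ∈ F.support) : ‖d s‖ ≤ 1 + ∑ s ∈ F.support, ‖d s‖ := by
    have := Finset.single_le_sum (f := fun s => ‖d s‖) (fun _ _ => norm_nonneg _) hs
    linarith
  -- Coefficients of lower z-degree may have norm above 1 after the normalisation; ‖M‖ < Γ⁻¹ absorbs
  -- them.
  set Γ := 1 + ∑ s ∈ F.support, ‖d s‖ with hΓdef
  have hΓ1 : 1 ≤ Γ := le_add_of_nonneg_right (Finset.sum_nonneg fun _ _ => norm_nonneg _)
  refine ⟨G, fun h => ?_, Γ⁻¹, by positivity, fun P x y w M hx hy hw hM hGxy hw0 hP => ?_⟩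
  · rw [h, MvPolynomial.coeff_zero] at hG
    exact zero_ne_one hG
  have hM1 : ‖M‖ ≤ 1 := hM.le.trans (inv_le_one_of_one_le₀ hΓ1)
  let t : O3 := ∑ s ∈ T, r s * (x ^ s 0 * y ^ s 1) * w ^ e
  have ht : IsLocalRing.residue O3 t ≠ 0 := by
    have : IsLocalRing.residue O3 t =
        MvPolynomial.eval ![IsLocalRing.residue O3 x, IsLocalRing.residue O3 y] G *
          IsLocalRing.residue O3 w ^ e := by
      simp only [t, G, map_sum, map_mul, map_pow, Finset.sum_mul]
      refine Finset.sum_congr rfl fun s _ => ?_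
      rw [MvPolynomial.eval_monomial, Finsupp.prod_fintype _ _ (by simp)]
      simp [π, Fin.prod_univ_two]
    rw [this]
    exact mul_ne_zero hGxy (pow_ne_zero _ hw0)
  refine ht (residue_eq_zero_iff.2 ?_)
  have hcoe : (t : ℂ_[3]) =
      ∑ s ∈ T, d s * ((x : ℂ_[3]) ^ s 0 * (y : ℂ_[3]) ^ s 1 * (w : ℂ_[3]) ^ s 2) * M ^ (e - s 2) := by
    have h1 : (t : ℂ_[3]) = O3.subtype t := rfl
    rw [h1]
    simp only [t, map_sum, map_mul, map_pow]
    refine Finset.sum_congr rfl fun s hs => ?_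
    have hse : s 2 = e := (Finset.mem_filter.1 hs).2
    simp only [ValuationSubring.coe_subtype, hr hs, hse, Nat.sub_self, pow_zero]
    ring
  have hzero : ∑ s ∈ F.support,
      d s * ((x : ℂ_[3]) ^ s 0 * (y : ℂ_[3]) ^ s 1 * (w : ℂ_[3]) ^ s 2) * M ^ (e - s 2) = 0 := by
    have h1 := congrArg toC3 hP
    rw [MvPolynomial.eval_eq', map_sum, map_zero] at h1
    have h2 := congrArg (fun z => z * (M ^ e / c s₀)) h1
    simp only [zero_mul, Finset.sum_mul] at h2
    rw [← h2]
    refine Finset.sum_congr rfl fun s hs => ?_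
    rw [Fin.prod_univ_three, map_mul, map_mul, map_mul, map_pow, map_pow, map_pow, ← hx, ← hy, hw]
    have hM : M ^ e = M ^ s 2 * M ^ (e - s 2) := by rw [← pow_add, Nat.add_sub_cancel' (he s hs)]
    rw [hM, mul_pow]
    simp only [d, c]
    ring
  rw [← Finset.sum_filter_add_sum_filter_not F.support (fun s => s 2 = e)] at hzero
  rw [hcoe, eq_neg_of_add_eq_zero_left hzero, norm_neg]
  refine lt_of_le_of_lt (IsUltrametricDist.norm_sum_le_of_forall_le_of_nonneg (C := Γ * ‖M‖)
    (by positivity) fun s hs => ?_) ?_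
  · obtain ⟨hs, hse⟩ := Finset.mem_filter.1 hs
    have hlt : s 2 < e := lt_of_le_of_ne (he s hs) hse
    have hn (z : O3) (k : ℕ) : ‖(z : ℂ_[3]) ^ k‖ ≤ 1 := by
      rw [norm_pow]
      exact pow_le_one₀ (norm_nonneg _) (mem_O3.1 z.2)
    rw [norm_mul, norm_mul]
    refine mul_le_mul ((mul_le_of_le_one_right (norm_nonneg _) ?_).trans (hΓ s hs)) ?_
      (norm_nonneg _) (by positivity)
    · rw [norm_mul, norm_mul]
      exact mul_le_one₀ (mul_le_one₀ (hn _ _) (norm_nonneg _) (hn _ _)) (norm_nonneg _) (hn _ _)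
    · rw [norm_pow]
      exact pow_le_of_le_one (norm_nonneg _) hM1 (by omega)
  · rwa [← lt_inv_mul_iff₀ (by positivity), mul_one]

/-- The elements of the residue field that lie in the field with `3 ^ 3 ^ m` elements. -/
noncomputable def fixedPts (m : ℕ) : Finset K3 :=
  haveI := Classical.decEq K3
  (Polynomial.X ^ 3 ^ 3 ^ m - Polynomial.X : Polynomial K3).roots.toFinset

lemma one_lt_three_pow_three_pow (m : ℕ) : 1 < 3 ^ 3 ^ m :=
  Nat.one_lt_pow (by positivity) (by norm_num)

lemma mem_fixedPts {m : ℕ} {a : K3} : a ∈ fixedPts m ↔ a ^ 3 ^ 3 ^ m = a := by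
  have h := FiniteField.X_pow_card_sub_X_ne_zero K3 (one_lt_three_pow_three_pow m)
  simp [fixedPts, h, sub_eq_zero]

lemma card_fixedPts (m : ℕ) : (fixedPts m).card = 3 ^ 3 ^ m := by
  classical
  have hsep : (Polynomial.X ^ 3 ^ 3 ^ m - Polynomial.X : Polynomial K3).Separable :=
    galois_poly_separable 3 _ (dvd_pow_self 3 (by positivity))
  rw [fixedPts, Multiset.toFinset_card_of_nodup]
  · rw [← (IsAlgClosed.splits _).natDegree_eq_card_roots,
      FiniteField.X_pow_card_sub_X_natDegree_eq K3 (one_lt_three_pow_three_pow m)]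
  · convert Polynomial.nodup_roots hsep

/-- The difference of the traces of the two coordinates, as a polynomial. -/
noncomputable def trDiffPoly (m : ℕ) : MvPolynomial (Fin 2) K3 :=
  ∑ i ∈ Finset.range (3 ^ m), (MvPolynomial.X 0 ^ 3 ^ i - MvPolynomial.X 1 ^ 3 ^ i)

lemma eval_trDiffPoly (m : ℕ) (v : Fin 2 → K3) :
    MvPolynomial.eval v (trDiffPoly m) = trThree m (v 0) - trThree m (v 1) := by
  simp [trDiffPoly, trThree, Finset.sum_sub_distrib]

lemma trDiffPoly_ne_zero (m : ℕ) : trDiffPoly m ≠ 0 := by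
  intro h
  have h1 := congrArg (MvPolynomial.coeff (Finsupp.single 0 1)) h
  rw [trDiffPoly, MvPolynomial.coeff_sum, MvPolynomial.coeff_zero,
    Finset.sum_eq_single_of_mem 0 (Finset.mem_range.2 (by positivity))] at h1
  · have hne : (Finsupp.single 1 1 : Fin 2 →₀ ℕ) ≠ Finsupp.single 0 1 := fun h => by
      have := DFunLike.congr_fun h 0
      simp at this
    simp [MvPolynomial.coeff_X, hne] at h1
  · intro i _ hi
    have : (3 : ℕ) ^ i ≠ 1 := (Nat.one_lt_pow hi (by norm_num)).ne'
    rw [MvPolynomial.coeff_sub, MvPolynomial.coeff_X_pow, MvPolynomial.coeff_X_pow, if_neg, if_neg,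
      sub_zero]
    · intro h
      have := DFunLike.congr_fun h 0
      simp at this
    · intro h
      have := DFunLike.congr_fun h 0
      simp at this
      omega

lemma totalDegree_trDiffPoly_le (m : ℕ) : (trDiffPoly m).totalDegree ≤ 3 ^ (3 ^ m - 1) := by
  refine MvPolynomial.totalDegree_finsetSum_le fun i hi => ?_
  have hi := Finset.mem_range.1 hi
  refine (MvPolynomial.totalDegree_sub _ _).trans (max_le ?_ ?_) <;>
  · rw [MvPolynomial.totalDegree_X_pow]
    exact Nat.pow_le_pow_right (by norm_num) (by omega)

/-- At least a third of the points of the plane over the field with `3 ^ 3 ^ m` elements lie outside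
of a given curve and have coordinates with different traces. -/
lemma card_good_residues [DecidableEq K3] {G : MvPolynomial (Fin 2) K3} (hG : G ≠ 0) {m : ℕ}
    (hm : 3 * G.totalDegree ≤ 3 ^ 3 ^ m) :
    3 ^ (2 * 3 ^ m) ≤ 3 * {v ∈ Fintype.piFinset fun _ : Fin 2 => fixedPts m |
      MvPolynomial.eval v (G * trDiffPoly m) ≠ 0}.card := by
  have hne : G * trDiffPoly m ≠ 0 := mul_ne_zero hG (trDiffPoly_ne_zero m)
  have hsz := MvPolynomial.schwartz_zippel_totalDegree hne (fixedPts m)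
  rw [card_fixedPts] at hsz
  set Z := {v ∈ Fintype.piFinset fun _ : Fin 2 => fixedPts m |
    MvPolynomial.eval v (G * trDiffPoly m) = 0}
  have hq : 3 ^ 3 ^ m = 3 * 3 ^ (3 ^ m - 1) := by
    rw [← pow_succ', Nat.sub_add_cancel (Nat.one_le_pow _ _ (by norm_num))]
  have hdeg : (G * trDiffPoly m).totalDegree ≤ G.totalDegree + 3 ^ (3 ^ m - 1) :=
    (MvPolynomial.totalDegree_mul _ _).trans (by gcongr; exact totalDegree_trDiffPoly_le m)
  set q := 3 ^ 3 ^ m with hqdef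
  have hq0 : 0 < q := by positivity
  have hZ : Z.card ≤ (G * trDiffPoly m).totalDegree * q := by
    have h1 : (0 : ℚ≥0) < q := by exact_mod_cast hq0
    rw [div_le_div_iff₀ (by positivity) h1] at hsz
    have h2 : Z.card * q ≤ (G * trDiffPoly m).totalDegree * q ^ 2 := by
      exact_mod_cast hsz
    rw [pow_two, ← mul_assoc] at h2
    exact Nat.le_of_mul_le_mul_right h2 hq0
  have hsum := Finset.card_filter_add_card_filter_not (s := Fintype.piFinset fun _ : Fin 2 =>
    fixedPts m) (fun v => MvPolynomial.eval v (G * trDiffPoly m) = 0)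
  rw [Fintype.card_piFinset_const, card_fixedPts] at hsum
  have hpow : 3 ^ (2 * 3 ^ m) = q ^ 2 := by rw [hqdef, ← pow_mul, mul_comm]
  rw [hpow]
  -- G and the trace difference each have degree at most q/3, so at most two thirds of the q² points
  -- are zeros of the product.
  have h3 : 3 * Z.card ≤ 2 * q ^ 2 := by
    calc 3 * Z.card ≤ 3 * ((G.totalDegree + 3 ^ (3 ^ m - 1)) * q) :=
          Nat.mul_le_mul_left _ (hZ.trans (Nat.mul_le_mul_right _ hdeg))
      _ = (3 * G.totalDegree + 3 * 3 ^ (3 ^ m - 1)) * q := by ring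
      _ ≤ (q + q) * q := by rw [← hq]; gcongr
      _ = 2 * q ^ 2 := by ring
  have h4 : Z.card + {v ∈ Fintype.piFinset fun _ : Fin 2 => fixedPts m |
      ¬ MvPolynomial.eval v (G * trDiffPoly m) = 0}.card = q ^ 2 := hsum
  simp only [ne_eq]
  omega

/-- Each cubing of 1 + t, with t divisible by 3, gains a factor 3 in the difference from 1; the
start is 2² - 1 = 3. -/
lemma norm_two_pow_sub_one_le (m : ℕ) : ‖(2 : ℂ_[3]) ^ (2 * 3 ^ m) - 1‖ ≤ (1 / 3) ^ (m + 1) := by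
  induction m with
  | zero =>
    have : (2 : ℂ_[3]) ^ (2 * 3 ^ 0) - 1 = 3 := by norm_num
    rw [this, norm_three_C3]
    norm_num
  | succ m ih =>
    set t := (2 : ℂ_[3]) ^ (2 * 3 ^ m) - 1 with ht
    have h2 : (2 : ℂ_[3]) ^ (2 * 3 ^ m) = t + 1 := by rw [ht]; ring
    have h : (2 : ℂ_[3]) ^ (2 * 3 ^ (m + 1)) - 1 = t * (3 * (t + 1) + t ^ 2) := by
      rw [pow_succ, ← mul_assoc, pow_mul, h2]
      ring
    have ht3 : ‖t‖ ≤ 1 / 3 := ih.trans (pow_le_of_le_one (by norm_num) (by norm_num) (by omega))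
    rw [h, norm_mul, pow_succ (1 / 3 : ℝ) (m + 1)]
    refine mul_le_mul ih ?_ (norm_nonneg _) (by positivity)
    refine (IsUltrametricDist.norm_add_le_max _ _).trans (max_le ?_ ?_)
    · rw [norm_mul, norm_three_C3]
      refine mul_le_of_le_one_right (by norm_num) ?_
      exact (IsUltrametricDist.norm_add_le_max _ _).trans
        (max_le (ht3.trans (by norm_num)) norm_one.le)
    · rw [norm_pow]
      nlinarith [norm_nonneg t]

/-- A positive proportion of the periodic points lie outside of a given hypersurface and have a
last coordinate of large `3`-adic absolute value. -/
lemma exists_many_periodic {F : MvPolynomial (Fin 3) Qbar} (hF : F ≠ 0) :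
    ∃ m₀ : ℕ, ∀ m ≥ m₀, ∃ U : Finset (Fin 3 → Qbar),
      (U : Set (Fin 3 → Qbar)) ⊆ Per (2 * 3 ^ m) (onPoints f) ∧ 3 ^ (2 * 3 ^ m) ≤ 3 * U.card ∧
      ∀ P ∈ U, MvPolynomial.eval P F ≠ 0 ∧ 3 ^ m ≤ ‖toC3 (P 2)‖ := by
  classical
  obtain ⟨G, hG, ε, hε, hGF⟩ := exists_residue_curve hF
  obtain ⟨m₁, hm₁⟩ := exists_pow_lt_of_lt_one hε (show (1 / 3 : ℝ) < 1 by norm_num)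
  refine ⟨max m₁ (3 * G.totalDegree), fun m hm => ?_⟩
  have hpow : ((1 : ℝ) / 3) ^ (m + 1) < ε := lt_of_le_of_lt
    (pow_le_pow_of_le_one (by norm_num) (by norm_num)
      (((le_max_left _ _).trans hm).trans m.le_succ)) hm₁
  have hdeg : 3 * G.totalDegree ≤ 3 ^ 3 ^ m := ((le_max_right _ _).trans hm).trans
    ((Nat.lt_pow_self (by norm_num)).le.trans (Nat.lt_pow_self (by norm_num)).le)
  set V := {v ∈ Fintype.piFinset fun _ : Fin 2 => fixedPts m |
    MvPolynomial.eval v (G * trDiffPoly m) ≠ 0} with hV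
  have hVcard : 3 ^ (2 * 3 ^ m) ≤ 3 * V.card := card_good_residues hG hdeg
  have hlift (v : Fin 2 → K3) (hv : v ∈ V) := by
    have h := Fintype.mem_piFinset.1 (Finset.mem_filter.1 hv).1
    exact exists_periodic_lift m (mem_fixedPts.1 (h 0)) (mem_fixedPts.1 (h 1))
  choose! P hP x y w hx hy hw hxa hyb hwt using hlift
  have hinj : Set.InjOn P V := by
    intro v hv v' hv' h
    have h0 : x v = x v' := Subtype.ext (by rw [hx v hv, hx v' hv', h])
    have h1 : y v = y v' := Subtype.ext (by rw [hy v hv, hy v' hv', h])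
    ext i
    fin_cases i
    · exact (hxa v hv).symm.trans ((congrArg _ h0).trans (hxa v' hv'))
    · exact (hyb v hv).symm.trans ((congrArg _ h1).trans (hyb v' hv'))
  refine ⟨V.image P, ?_, ?_, ?_⟩
  · intro Q hQ
    obtain ⟨v, hv, rfl⟩ := Finset.mem_image.1 hQ
    exact hP v hv
  · rwa [Finset.card_image_of_injOn hinj]
  · intro Q hQ
    obtain ⟨v, hv, rfl⟩ := Finset.mem_image.1 hQ
    have hne := (Finset.mem_filter.1 hv).2
    rw [map_mul, eval_trDiffPoly] at hne
    have hw0 : IsLocalRing.residue O3 (w v) ≠ 0 := by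
      rw [hwt v hv]
      exact right_ne_zero_of_mul hne
    have hM := norm_two_pow_sub_one_le m
    refine ⟨hGF (P v) (x v) (y v) (w v) _ (hx v hv) (hy v hv) (hw v hv) (hM.trans_lt hpow) ?_ hw0,
      ?_⟩
    · have hvec : ![IsLocalRing.residue O3 (x v), IsLocalRing.residue O3 (y v)] = v := by
        ext i
        fin_cases i
        exacts [hxa v hv, hyb v hv]
      rw [hvec]
      exact left_ne_zero_of_mul hne
    -- A nonzero residue means that (2ⁿ - 1)z is a unit, so the smallness of 2ⁿ - 1 makes z large.
    · rw [Ne, residue_eq_zero_iff, not_lt, hw v hv, norm_mul] at hw0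
      have h1 : 1 ≤ (1 / 3 : ℝ) ^ m * ‖toC3 (P v 2)‖ := by
        refine hw0.trans ?_
        gcongr
        exact hM.trans (pow_le_pow_of_le_one (by norm_num) (by norm_num) m.le_succ)
      rwa [one_div, inv_pow, inv_mul_eq_div, one_le_div (by positivity)] at h1

end Avoid

end AffineDyn

namespace AffineDyn

/-! ### Galois orbits of periodic points and unbounded height -/

section Conjugates

/-- If `U` contains at least a third of `S`, then it contains at least a third of some class that
it meets, for every partition of `S` into classes. -/
lemma exists_fiber_card_le {α β : Type*} [DecidableEq β] (q : α → β) {S U : Finset α}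
    (hU : U.Nonempty) (hcard : S.card ≤ 3 * U.card) :
    ∃ P ∈ U, {Q ∈ S | q Q = q P}.card ≤ 3 * {Q ∈ U | q Q = q P}.card := by
  by_contra! h
  have hS : ∑ b ∈ U.image q, {Q ∈ S | q Q = b}.card ≤ S.card := by
    rw [Finset.sum_card_fiberwise_eq_card_filter]
    exact Finset.card_filter_le _ _
  have hUc : U.card = ∑ b ∈ U.image q, {Q ∈ U | q Q = b}.card :=
    Finset.card_eq_sum_card_fiberwise fun x hx => Finset.mem_image_of_mem q hx
  have hlt : ∑ b ∈ U.image q, 3 * {Q ∈ U | q Q = b}.card <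
      ∑ b ∈ U.image q, {Q ∈ S | q Q = b}.card := by
    refine Finset.sum_lt_sum_of_nonempty (hU.image q) fun b hb => ?_
    obtain ⟨P, hP, rfl⟩ := Finset.mem_image.1 hb
    exact h P hP
  rw [← Finset.mul_sum, ← hUc] at hlt
  omega

/-- The Galois orbit of a point. -/
def galoisOrbit {N : ℕ} (P : Fin N → Qbar) : Set (Fin N → Qbar) :=
  Set.range fun (γ : Qbar ≃ₐ[ℚ] Qbar) i => γ (P i)

lemma galoisOrbit_eq {N : ℕ} (P : Fin N → Qbar) (γ : Qbar ≃ₐ[ℚ] Qbar) :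
    galoisOrbit (fun i => γ (P i)) = galoisOrbit P := by
  ext Q
  constructor
  · rintro ⟨δ, rfl⟩
    exact ⟨γ.trans δ, rfl⟩
  · rintro ⟨δ, rfl⟩
    exact ⟨γ.symm.trans δ, by simp⟩

lemma exists_of_galoisOrbit_eq {N : ℕ} {P Q : Fin N → Qbar} (h : galoisOrbit Q = galoisOrbit P) :
    ∃ γ : Qbar ≃ₐ[ℚ] Qbar, (fun i => γ (P i)) = Q := by
  have : Q ∈ galoisOrbit Q := ⟨AlgEquiv.refl, rfl⟩
  rwa [h] at this

/-- An embedding of the field of definition of `P` is determined by the image of `P`. -/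
lemma conjugate_injective {N : ℕ} (P : Fin N → Qbar) : Function.Injective
    fun (σ : fieldOfDef P →ₐ[ℚ] Qbar) i => σ (coords P i) := by
  intro σ τ h
  refine IntermediateField.algHom_ext_of_eq_adjoin _ rfl ?_
  rintro _ ⟨i, rfl⟩
  exact congrFun h i

lemma exists_extend {N : ℕ} (P : Fin N → Qbar) (σ : fieldOfDef P →ₐ[ℚ] Qbar) :
    ∃ γ : Qbar ≃ₐ[ℚ] Qbar, ∀ i, γ (P i) = σ (coords P i) := by
  obtain ⟨φ, rfl⟩ := IsAlgClosed.surjective_domRestrict_of_isAlgebraic (E := Qbar) σ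
  exact ⟨AlgEquiv.ofBijective φ (Algebra.IsAlgebraic.algHom_bijective φ), fun i => rfl⟩

lemma onPoints_galois {N : ℕ} (F : Fin N → MvPolynomial (Fin N) ℚ) (γ : Qbar ≃ₐ[ℚ] Qbar)
    (P : Fin N → Qbar) (n : ℕ) :
    (onPoints F)^[n] (fun i => γ (P i)) = fun i => γ ((onPoints F)^[n] P i) := by
  have h (P : Fin N → Qbar) : onPoints F (fun i => γ (P i)) = fun i => γ (onPoints F P i) := by
    ext i
    simp only [onPoints]
    exact (MvPolynomial.comp_aeval_apply P γ.toAlgHom (F i)).symm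
  induction n generalizing P with
  | zero => rfl
  | succ n ih => rw [Function.iterate_succ_apply, h, ih, Function.iterate_succ_apply]

end Conjugates

/-- Outside of every hypersurface there are periodic points of arbitrarily large height. -/
lemma exists_periodic_height_gt {F : MvPolynomial (Fin 3) Qbar} (hF : F ≠ 0) (B : ℝ) :
    ∃ P ∈ PerAll (onPoints f), MvPolynomial.eval P F ≠ 0 ∧ B < height P := by
  classical
  obtain ⟨m₀, h⟩ := exists_many_periodic hF
  -- Chosen so that (m log 3)/3 exceeds B; the 1/3 is the proportion of good conjugates.
  obtain ⟨m₁, hm₁⟩ := exists_nat_gt (3 * B / Real.log 3)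
  set m := max m₀ m₁
  obtain ⟨U, hU, hUcard, hUP⟩ := h m (le_max_left _ _)
  have hn : 1 ≤ 2 * 3 ^ m := Nat.succ_le_of_lt (by positivity)
  set n := 2 * 3 ^ m
  set S := (finite_Per hn).toFinset with hSdef
  have hScard : S.card ≤ 3 * U.card := by
    rw [hSdef, ← Set.ncard_eq_toFinset_card _ (finite_Per hn)]
    exact (ncard_Per_le hn).trans hUcard
  have hUne : U.Nonempty := by
    rw [← Finset.card_pos]
    have : 0 < 3 ^ n := by positivity
    omega
  obtain ⟨P, hPU, hP⟩ := exists_fiber_card_le galoisOrbit hUne hScard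
  have hPper : (onPoints f)^[n] P = P := hU hPU
  refine ⟨P, ⟨n, hn, hPper⟩, (hUP P hPU).1, ?_⟩
  let c : (fieldOfDef P →ₐ[ℚ] Qbar) → Fin 3 → Qbar := fun σ i => σ (coords P i)
  have hc : Function.Injective c := conjugate_injective P
  let I : Finset (fieldOfDef P →ₐ[ℚ] Qbar) := {σ | c σ ∈ U}
  have hheight := le_height_of_conjugates P 2 m I fun σ hσ =>
    (hUP _ (Finset.mem_filter.1 hσ).2).2
  -- The embeddings of the field of P give distinct conjugates of P, which are again n-periodic
  -- because f is defined over ℚ.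
  have hall : Module.finrank ℚ (fieldOfDef P) ≤ {Q ∈ S | galoisOrbit Q = galoisOrbit P}.card := by
    rw [← AlgHom.card ℚ (fieldOfDef P) Qbar, ← Finset.card_univ]
    refine Finset.card_le_card_of_injOn c (fun σ _ => ?_) hc.injOn
    obtain ⟨γ, hγ⟩ := exists_extend P σ
    have hcσ : c σ = fun i => γ (P i) := funext fun i => (hγ i).symm
    rw [Finset.mem_coe, Finset.mem_filter, hSdef, Set.Finite.mem_toFinset, hcσ]
    refine ⟨?_, galoisOrbit_eq P γ⟩
    change (onPoints f)^[n] _ = _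
    rw [onPoints_galois, hPper]
  have hI : {Q ∈ U | galoisOrbit Q = galoisOrbit P}.card ≤ I.card := by
    rw [← Finset.card_image_of_injective I hc]
    refine Finset.card_le_card fun Q hQ => ?_
    obtain ⟨hQU, hQ⟩ := Finset.mem_filter.1 hQ
    obtain ⟨γ, rfl⟩ := exists_of_galoisOrbit_eq hQ
    exact Finset.mem_image.2 ⟨γ.toAlgHom.comp (fieldOfDef P).val,
      Finset.mem_filter.2 ⟨Finset.mem_univ _, hQU⟩, rfl⟩
  have hfin : (0 : ℝ) < Module.finrank ℚ (fieldOfDef P) := by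
    exact_mod_cast Module.finrank_pos
  have hthird : (1 / 3 : ℝ) ≤ I.card / Module.finrank ℚ (fieldOfDef P) := by
    rw [div_le_div_iff₀ (by norm_num) hfin]
    have : Module.finrank ℚ (fieldOfDef P) ≤ 3 * I.card := by omega
    have : (Module.finrank ℚ (fieldOfDef P) : ℝ) ≤ 3 * I.card := by exact_mod_cast this
    linarith
  have hlog : 0 < Real.log 3 := Real.log_pos (by norm_num)
  have hm : (m₁ : ℝ) ≤ m := by exact_mod_cast le_max_right m₀ m₁
  rw [div_lt_iff₀ hlog] at hm₁
  calc B < 1 / 3 * (m * Real.log 3) := by nlinarith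
    _ ≤ I.card / Module.finrank ℚ (fieldOfDef P) * (m * Real.log 3) := by gcongr
    _ ≤ height P := hheight

end AffineDyn

/-! ### Isolated points, automorphism property, Zariski density and conclusion -/

namespace AffineDyn

lemma mem_zariskiClosure_iff {N : ℕ} {S : Set (Fin N → Qbar)} {P : Fin N → Qbar} :
    P ∈ zariskiClosure S ↔ ∀ F : MvPolynomial (Fin N) Qbar,
      (∀ Q ∈ S, MvPolynomial.eval Q F = 0) → MvPolynomial.eval P F = 0 := by
  simp only [zariskiClosure, MvPolynomial.mem_zeroLocus_iff, MvPolynomial.mem_vanishingIdeal_iff,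
    MvPolynomial.aeval_eq_eval]

/-- A polynomial separating a point from another one. -/
lemma exists_separating {N : ℕ} {P Q : Fin N → Qbar} (h : Q ≠ P) :
    ∃ F : MvPolynomial (Fin N) Qbar, MvPolynomial.eval Q F = 0 ∧ MvPolynomial.eval P F ≠ 0 := by
  obtain ⟨i, hi⟩ := Function.ne_iff.1 h
  exact ⟨MvPolynomial.X i - MvPolynomial.C (Q i), by simp, by simpa [sub_eq_zero] using hi.symm⟩

/-- A point is not in the Zariski closure of a finite set that does not contain it. -/
lemma notMem_zariskiClosure {N : ℕ} {S : Set (Fin N → Qbar)} (hS : S.Finite) {P : Fin N → Qbar}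
    (hP : P ∉ S) : P ∉ zariskiClosure S := by
  have h (Q : Fin N → Qbar) (hQ : Q ∈ S) := exists_separating (ne_of_mem_of_not_mem hQ hP)
  choose! F hFQ hFP using h
  rw [mem_zariskiClosure_iff]
  intro h
  have h0 := h (∏ Q ∈ hS.toFinset, F Q) fun Q hQ => by
    rw [map_prod]
    exact Finset.prod_eq_zero (hS.mem_toFinset.2 hQ) (hFQ Q hQ)
  rw [map_prod] at h0
  obtain ⟨Q, hQ, hQ0⟩ := Finset.prod_eq_zero_iff.1 h0
  exact hFP Q (hS.mem_toFinset.1 hQ) hQ0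

lemma mem_isolatedPer {N : ℕ} {φ : (Fin N → Qbar) → (Fin N → Qbar)}
    (hφ : ∀ n, 1 ≤ n → (Per n φ).Finite) {P : Fin N → Qbar} (hP : P ∈ PerAll φ) :
    P ∈ IsolatedPer φ :=
  ⟨hP, fun n hn => notMem_zariskiClosure ((hφ n hn).subset Set.sdiff_subset) fun h => h.2 rfl⟩

lemma isAutomorphism_of_comp {N : ℕ} {k : Type} [Field k] {F G : Fin N → MvPolynomial (Fin N) k}
    (hGF : ∀ i, MvPolynomial.aeval G (F i) = MvPolynomial.X i)
    (hFG : ∀ i, MvPolynomial.aeval F (G i) = MvPolynomial.X i) : IsAutomorphism F := by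
  have h1 : (MvPolynomial.aeval G).comp (MvPolynomial.aeval F) = AlgHom.id k _ :=
    MvPolynomial.algHom_ext fun i => by simpa using hGF i
  have h2 : (MvPolynomial.aeval F).comp (MvPolynomial.aeval G) = AlgHom.id k _ :=
    MvPolynomial.algHom_ext fun i => by simpa using hFG i
  refine Function.bijective_iff_has_inverse.2
    ⟨MvPolynomial.aeval (R := k) G, fun p => ?_, fun p => ?_⟩
  · rw [← AlgHom.comp_apply, h1, AlgHom.id_apply]
  · rw [← AlgHom.comp_apply, h2, AlgHom.id_apply]

open MvPolynomial in
-- Needed over ℚ for f itself and over `Qbar` to contradict the conjecture.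
lemma isAutomorphism_map_f {k : Type} [Field k] [Algebra ℚ k] :
    IsAutomorphism fun i => map (algebraMap ℚ k) (f i) := by
  obtain ⟨c, hc⟩ : ∃ c : MvPolynomial (Fin 3) k, c = C (algebraMap ℚ k 2⁻¹) := ⟨_, rfl⟩
  have h2 : 2 * c = 1 := by
    rw [hc, ← map_ofNat (C : k →+* MvPolynomial (Fin 3) k) 2, ← map_ofNat (algebraMap ℚ k) 2,
      ← C_mul, ← map_mul, mul_inv_cancel₀ two_ne_zero, map_one, C_1]
  have hac (G : Fin 3 → MvPolynomial (Fin 3) k) : aeval G c = c := by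
    rw [hc, aeval_C, algebraMap_eq]
  have hF0 : map (algebraMap ℚ k) (f 0) = X 1 := by simp [f]
  have hF1 : map (algebraMap ℚ k) (f 1) = X 0 + X 1 - X 1 ^ 3 := by simp [f]
  have hF2 : map (algebraMap ℚ k) (f 2) = 2 * X 2 - X 1 := by simp [f]
  refine isAutomorphism_of_comp (G := ![X 1 - X 0 + X 0 ^ 3, X 0, c * (X 2 + X 0)]) ?_ ?_
  · refine Fin.forall_fin_succ.2 ⟨?_, Fin.forall_fin_two.2 ⟨?_, ?_⟩⟩
    · simp only [hF0, aeval_X]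
      rfl
    · change aeval _ (map (algebraMap ℚ k) (f 1)) = X 1
      simp only [hF1, map_add, map_sub, map_pow, aeval_X, Matrix.cons_val]
      ring
    · change aeval _ (map (algebraMap ℚ k) (f 2)) = X 2
      simp only [hF2, map_mul, map_sub, map_ofNat, aeval_X, Matrix.cons_val]
      linear_combination (X 2 + X 0) * h2
  · refine Fin.forall_fin_succ.2 ⟨?_, Fin.forall_fin_two.2 ⟨?_, ?_⟩⟩
    · simp only [Matrix.cons_val, hF0, hF1, map_add, map_sub, map_pow, aeval_X]
      ring
    · change aeval _ (X 0) = X 1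
      rw [aeval_X, hF0]
    · change aeval _ (c * (X 2 + X 0)) = X 2
      simp only [map_mul, map_add, hac, aeval_X, hF0, hF2]
      linear_combination X 2 * h2

lemma map_id_f : (fun i => MvPolynomial.map (algebraMap ℚ ℚ) (f i)) = f :=
  funext fun i => MvPolynomial.map_id (f i)

lemma isAutomorphism_f : IsAutomorphism f :=
  map_id_f ▸ isAutomorphism_map_f (k := ℚ)

open MvPolynomial in
lemma two_le_degree_map_f {k : Type} [Field k] [Algebra ℚ k] :
    2 ≤ degree fun i => map (algebraMap ℚ k) (f i) := by
  refine le_trans ?_ (Finset.le_sup (f := fun i => (map (algebraMap ℚ k) (f i)).totalDegree)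
    (Finset.mem_univ 1))
  have hs : Finsupp.single (1 : Fin 3) 3 ∈ (map (algebraMap ℚ k) (f 1)).support := by
    rw [mem_support_iff]
    simp [f, coeff_X_pow, coeff_X, Finsupp.single_eq_single_iff]
  refine le_trans ?_ (le_totalDegree hs)
  simp

lemma two_le_degree_f : 2 ≤ degree f :=
  map_id_f ▸ two_le_degree_map_f (k := ℚ)

lemma onPoints_map_f : onPoints (fun i => MvPolynomial.map (algebraMap ℚ Qbar) (f i)) =
    onPoints f := by
  ext P i
  simp only [onPoints]
  exact MvPolynomial.aeval_map_algebraMap Qbar P (f i)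

instance countable_Qbar : Countable Qbar := by
  rw [← Cardinal.mk_le_aleph0_iff]
  exact (Algebra.IsAlgebraic.cardinalMk_le_max ℚ Qbar).trans (by simp)

instance countable_mvPolynomial : Countable (MvPolynomial (Fin 3) Qbar) := by
  rw [← Cardinal.mk_le_aleph0_iff]
  exact MvPolynomial.cardinalMk_le_max.trans (by simp)

/-- The nonzero polynomials over `Qbar` are enumerated; the i-th point avoids the i-th hypersurface
and has height above i. -/
lemma exists_dense_sequence : ∃ P : ℕ → (Fin 3 → Qbar), (∀ i, P i ∈ PerAll (onPoints f)) ∧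
    Tendsto (fun i => height (P i)) atTop atTop ∧ zariskiClosure (Set.range P) = Set.univ := by
  have : Nonempty {F : MvPolynomial (Fin 3) Qbar // F ≠ 0} := ⟨⟨1, one_ne_zero⟩⟩
  obtain ⟨F, hF⟩ := exists_surjective_nat {F : MvPolynomial (Fin 3) Qbar // F ≠ 0}
  choose P hP hPF hPh using fun i : ℕ => exists_periodic_height_gt (F i).2 i
  refine ⟨P, hP, tendsto_atTop_mono (fun i => (hPh i).le) tendsto_natCast_atTop_atTop, ?_⟩
  refine Set.eq_univ_of_forall fun Q => mem_zariskiClosure_iff.2 fun G hG => ?_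
  by_cases h : G = 0
  · rw [h, map_zero]
  · obtain ⟨i, hi⟩ := hF ⟨G, h⟩
    refine absurd (hG (P i) ⟨i, rfl⟩) ?_
    have := hPF i
    rwa [hi] at this

lemma not_heightBounded : ¬ HeightBounded (IsolatedPer (onPoints f)) := by
  rintro ⟨C, hC⟩
  obtain ⟨P, hP, -, h⟩ := exists_periodic_height_gt (one_ne_zero) C
  exact (h.trans_le ((le_abs_self _).trans
    (hC P (mem_isolatedPer (fun n hn => finite_Per hn) hP)))).false

end AffineDyn

open AffineDyn in
theorem theorem2p1 :
    -- `f` is an automorphism and both dynamical degrees are `3`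
    (IsAutomorphism f ∧ HasDynamicalDegree (onPoints f) 1 3 ∧
      HasDynamicalDegree (onPoints f) 2 3) ∧
    -- finitely many `n`-periodic points, and all periodic points are isolated
    ((∀ n : ℕ, 1 ≤ n → (Per n (onPoints f)).Finite) ∧
      ∀ P ∈ PerAll (onPoints f), P ∈ IsolatedPer (onPoints f)) ∧
    -- a Zariski dense sequence of periodic points whose height tends to infinity
    (∃ P : ℕ → (Fin 3 → Qbar), (∀ i, P i ∈ PerAll (onPoints f)) ∧
      Tendsto (fun i => height (P i)) atTop atTop ∧
      zariskiClosure (Set.range P) = Set.univ) ∧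
    -- hence `f` is a counterexample to Silverman's conjecture
    (2 ≤ degree f ∧ ¬ HeightBounded (IsolatedPer (onPoints f)) ∧ ¬ SilvermanConjecture) := by
  refine ⟨⟨isAutomorphism_f, ?_, ?_⟩, ⟨fun n hn => finite_Per hn, fun P hP =>
    mem_isolatedPer (fun n hn => finite_Per hn) hP⟩, exists_dense_sequence, two_le_degree_f,
    not_heightBounded, fun h => not_heightBounded ?_⟩
  · exact_mod_cast hasDynamicalDegree_of_pow hasDegree_one
  · exact_mod_cast hasDynamicalDegree_of_pow hasDegree_two
  · rw [← onPoints_map_f]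
    exact h 3 _ isAutomorphism_map_f two_le_degree_map_f
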